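/- Let $M$ be a compact connected topological $2$-manifold with (possibly empty) boundary, and let $f\colon M\to\mathbf{R}^3$ be a locally convex immersion, i.e., a continuous locally one-to-one map such that each point of $M$ has a neighborhood which $f$ sends into the boundary of a convex body (a compact convex set with nonempty interior) in $\mathbf{R}^3$. Suppose that $f$ is locally nonflat along $\partial M$, i.e., no point of $\partial M$ has a neighborhood in $M$ which $f$ maps into a plane, and that $f|_{\partial M}$ is $\mathcal{C}^2$ without inflections, i.e., near every point of $\partial M$ there is a local parametrization of $\partial M$ by an open subset of $\mathbf{R}$ in which $f|_{\partial M}$ is twice continuously differentiable with nonvanishing derivative and nonvanishing curvature. Let $p$ be an interior point of $M$ and let $H$ be a local support plane of $f$ at $p$, i.e., a plane $H\subset\mathbf{R}^3$ with $f(p)\in H$ such that $f$ maps some neighborhood of $p$ into one of the two closed half-spaces bounded by $H$. Let $A$ be the connected component of $f^{-1}(H)$ which contains $p$. Then $A$ is a (degenerate) cap with plane $H$. That is, $A$ is closed and connected; $f$ is one-to-one on $A$; $f(A)$ is a nonempty compact convex subset of $H$ (hence a point, a line segment, or a convex disk in $H$); and there are a neighborhood $U$ of $A$ in $M$ and a closed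 half-space $H^+$ bounded by $H$ such that $f(U\setminus A)\cap H^+=\emptyset$. (It is not assumed that $A\cap\partial M=\emptyset$.) -/

import Mathlib

open Set Topology
open scoped Manifold

/-- Euclidean 3-space. -/
abbrev R3 : Type := EuclideanSpace ℝ (Fin 3)

/-- `H` is a plane in `ℝ³`. -/
def IsPlane (H : Set R3) : Prop :=
  ∃ (n : R3) (c : ℝ), n ≠ 0 ∧ H = {x | inner ℝ n x = c}

/-- `S` is a side of the plane `H`, i.e. one of the two closed half-spaces bounded by `H`
(the other one is obtained by replacing `(n, c)` with `(-n, -c)`). -/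
def IsSide (S H : Set R3) : Prop :=
  ∃ (n : R3) (c : ℝ), n ≠ 0 ∧ H = {x | inner ℝ n x = c} ∧ S = {x | c ≤ inner ℝ n x}

/-- A convex body in `ℝ³`: a compact convex set with interior points. -/
def IsConvexBody (K : Set R3) : Prop :=
  IsCompact K ∧ Convex ℝ K ∧ (interior K).Nonempty

section

variable {M : Type*} [TopologicalSpace M]

/-- A locally convex immersion: a continuous locally one-to-one map which sends a neighborhood of
each point into the boundary of a convex body. -/
def IsLocallyConvexImmersion (f : M → R3) : Prop :=
  Continuous f ∧
    (∀ p : M, ∃ U ∈ 𝓝 p, InjOn f U) ∧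
    ∀ p : M, ∃ U ∈ 𝓝 p, ∃ K : Set R3, IsConvexBody K ∧ f '' U ⊆ frontier K

/-- `H` is a local support plane of `f` at `p`: a plane through `f p` such that some neighborhood
of `p` is mapped by `f` to one side of `H`. -/
def IsLocalSupportPlane (f : M → R3) (H : Set R3) (p : M) : Prop :=
  IsPlane H ∧ f p ∈ H ∧ ∃ U ∈ 𝓝 p, ∃ S : Set R3, IsSide S H ∧ f '' U ⊆ S

/-- A degenerate cap in `ℝ³` with plane `H`: a nonempty compact convex subset of the plane `H`
(so a point, a line segment or a convex disk in `H`). -/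
def IsDegenerateCapInSpace (D H : Set R3) : Prop :=
  IsPlane H ∧ D.Nonempty ∧ IsCompact D ∧ Convex ℝ D ∧ D ⊆ H

/-- `C ⊆ M` is a degenerate cap of `M` with plane `H`: it is closed and connected, `f` maps it
injectively onto a degenerate cap in `ℝ³` with plane `H`, and for some neighborhood `U` of `C` the
set `f (U \ C)` is disjoint from a closed half-space bounded by `H`. -/
def IsDegenerateCap (f : M → R3) (C : Set M) (H : Set R3) : Prop :=
  IsClosed C ∧ IsConnected C ∧ InjOn f C ∧ IsDegenerateCapInSpace (f '' C) H ∧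
    ∃ U ∈ 𝓝ˢ C, ∃ S : Set R3, IsSide S H ∧ Disjoint (f '' (U \ C)) S

variable [ChartedSpace (EuclideanHalfSpace 2) M]

/-- No boundary point of the surface has a neighborhood which `f` maps into a plane. -/
def IsLocallyNonflatAlongBoundary (f : M → R3) : Prop :=
  ∀ p ∈ (𝓡∂ 2).boundary M, ∀ U ∈ 𝓝 p, ¬ ∃ H : Set R3, IsPlane H ∧ f '' U ⊆ H

/-- The restriction of `f` to `∂M` is a (regular) `C²` curve without inflections: `∂M` is covered
by local coordinates `e` to `ℝ` in which the restriction is a twice continuously differentiable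
curve `γ` whose velocity and acceleration are linearly independent, that is, `γ' ≠ 0` and the
curvature of `γ` does not vanish. -/
def IsC2WithoutInflectionsOnBoundary (f : M → R3) : Prop :=
  ∀ q : (𝓡∂ 2).boundary M, ∃ e : OpenPartialHomeomorph ((𝓡∂ 2).boundary M) ℝ,
    q ∈ e.source ∧
    ContDiffOn ℝ 2 (fun t : ℝ => f (e.symm t : M)) e.target ∧
    ∀ t ∈ e.target, LinearIndependent ℝ
      ![deriv (fun t : ℝ => f (e.symm t : M)) t,
        deriv (deriv (fun t : ℝ => f (e.symm t : M))) t]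

end

/-! Write `H` as ⟪n, x⟫ = c. Where `M` is locally a plane, `f` covers a neighborhood in the boundary
of its local convex body `K`: central projection of ∂K from an interior point to a plane reduces
this to invariance of domain in dimension two. Hence if `f` lies on one side of `H` near such a
point, so does ∂K, and `H` misses the interior of `K`. This last fact concerns `K` alone, so it
passes to every `q` in the closure of `supportPoints`, including points of ∂M.

The local claim (`hasConvexPatch`) is that near such a `q` the set f⁻¹(H) is embedded onto a convex
set and stays in that closure. At planar points the image is the face K ∩ H cut by a small ball. At
the remaining points of ∂M one asks how much of the face `f` fills. If the face has interior in `H`,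
nonflatness keeps ∂M away from that interior; a connectedness argument then fills it near f(q), and
closedness adds its boundary. If the face lies in a line, absence of inflections isolates `q` among
the boundary points mapped to that line, and connectedness fills the segments ending at f(q).

By connectedness the whole component `A` lies in the closure of `supportPoints`, so it is covered by
embedded patches with convex images. The local-to-global principle
`injective_and_convex_range_of_local`, proved by minimizing the energy of chains, makes `f`
injective on `A` with convex image. Finally `f` is flat exactly at the points of `A` over the
relative interior of f(A). At all others it has exactly one local side of `H`; the side is locally
constant, hence constant since the relative boundary of f(A) is connected
(`IsConvexComponent.one_sided`). -/

/-! ### Invariance of domain in dimension two. -/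

/-- A nowhere vanishing continuous function on the plane cannot be close to the identity on the unit
circle. -/
theorem not_exists_ne_zero_near_id_on_circle (u : ℂ → ℂ) (hu : Continuous u) (h0 : ∀ z, u z ≠ 0)
    (h1 : ∀ z : ℂ, ‖z‖ = 1 → ‖u z - z‖ < 1) : False := by
  let v : C(ℂ, Circle) := ⟨fun z => ⟨u z / ‖u z‖, by
    rw [Submonoid.unitSphere, Submonoid.mem_mk, Subsemigroup.mem_mk, mem_sphere_zero_iff_norm]
    simp [h0 z]⟩, by
    refine Continuous.subtype_mk ?_ _
    exact hu.div (by fun_prop) (fun z => by simpa using h0 z)⟩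
  obtain ⟨t₀, ht₀⟩ : ∃ t, Circle.exp t = v 0 := Circle.exp_surjective _
  obtain ⟨θ, ⟨-, hθ⟩, -⟩ :=
    Circle.isCoveringMap_exp.existsUnique_continuousMap_lifts v 0 t₀ ht₀
  have hθ' : ∀ z, Complex.exp (θ z * Complex.I) = u z / ‖u z‖ := fun z => by
    have := congrArg (Subtype.val) (congrFun hθ z)
    rw [Function.comp_apply, Circle.coe_exp] at this
    exact this
  let e : ℝ → ℂ := fun t => Complex.exp (t * Complex.I)
  have he : Continuous e := by fun_prop
  have hne : ∀ t, ‖e t‖ = 1 := fun t => Complex.norm_exp_ofReal_mul_I t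
  have hne0 : ∀ t, e t ≠ 0 := fun t => Complex.exp_ne_zero _
  let w : ℝ → ℂ := fun t => u (e t) / e t
  have hw : Continuous w := (hu.comp he).div he hne0
  have hw1 : ∀ t, w t ∈ Complex.slitPlane := fun t => by
    suffices ‖w t - 1‖ < 1 by simpa using Complex.mem_slitPlane_of_norm_lt_one this
    have : w t - 1 = (u (e t) - e t) / e t := by
      simp only [w]; rw [sub_div, div_self (hne0 t)]
    rw [this, norm_div, hne, div_one]
    exact h1 _ (hne t)
  let φ : ℝ → ℝ := fun t => θ (e t) - t - (w t).arg
  have hφ : Continuous φ := by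
    refine ((θ.continuous.comp he).sub continuous_id).sub ?_
    rw [continuous_iff_continuousAt]
    intro t
    exact (Complex.continuousAt_arg (hw1 t)).comp hw.continuousAt
  have hφ1 : ∀ t, Complex.exp (φ t * Complex.I) = 1 := fun t => by
    have hwn : ‖w t‖ = ‖u (e t)‖ := by simp [w, hne]
    have hw0 : (‖u (e t)‖ : ℂ) ≠ 0 := by simpa using h0 (e t)
    have harg : Complex.exp ((w t).arg * Complex.I) = w t / ‖u (e t)‖ := by
      rw [eq_div_iff hw0, mul_comm, ← hwn, Complex.norm_mul_exp_arg_mul_I]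
    have h2 : (φ t : ℂ) * Complex.I
        = θ (e t) * Complex.I - t * Complex.I - (w t).arg * Complex.I := by
      simp only [φ]; push_cast; ring
    rw [h2, Complex.exp_sub, Complex.exp_sub, harg, hθ']
    change u (e t) / ‖u (e t)‖ / e t / (u (e t) / e t / ‖u (e t)‖) = 1
    have := h0 (e t)
    have := hne0 t
    field_simp
  have hper : φ (2 * Real.pi) = φ 0 - 2 * Real.pi := by
    have : e (2 * Real.pi) = e 0 := by simp [e]
    simp only [φ, w, this]; ring
  -- By `hφ1` the continuous function `φ` takes values in 2πℤ, yet it drops by 2π over one turn, so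
  -- it would also take the forbidden value φ(0) - π.
  obtain ⟨t, -, ht⟩ := intermediate_value_Icc' (by positivity : (0 : ℝ) ≤ 2 * Real.pi)
    hφ.continuousOn (show φ 0 - Real.pi ∈ Icc (φ (2 * Real.pi)) (φ 0) by
      rw [hper]; constructor <;> linarith [Real.pi_pos])
  have h3 := hφ1 t
  rw [ht] at h3
  push_cast at h3
  rw [sub_mul, Complex.exp_sub, hφ1 0, Complex.exp_pi_mul_I] at h3
  norm_num at h3

/-- If points `c` outside the image `X` came arbitrarily close to h(0), one could push `X` radially
out of a disk around `c` containing h(0). An extension `G` of the inverse of `h` vanishes on `X`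
only at h(0), so after a small perturbation it has no zero on the pushed set. Composed with `h` and
the retraction to the disk, it contradicts `not_exists_ne_zero_near_id_on_circle`. -/
theorem image_closedBall_mem_nhds_of_injOn (h : ℂ → ℂ)
    (hc : ContinuousOn h (Metric.closedBall 0 1)) (hi : InjOn h (Metric.closedBall 0 1)) :
    h '' Metric.closedBall 0 1 ∈ 𝓝 (h 0) := by
  by_contra hX
  set D : Set ℂ := Metric.closedBall 0 1
  set X := h '' D
  have h0D : (0 : ℂ) ∈ D := by simp [D]
  have hDc : IsCompact D := isCompact_closedBall 0 1
  have hXc : IsCompact X := hDc.image_of_continuousOn hc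
  have : CompactSpace D := isCompact_iff_compactSpace.mp hDc
  have hemb : IsClosedEmbedding (D.domRestrict h) :=
    (continuousOn_iff_continuous_domRestrict.mp hc).isClosedEmbedding (injOn_iff_injective.mp hi)
  obtain ⟨G, hG⟩ := ContinuousMap.exists_extension' hemb (⟨Subtype.val, continuous_subtype_val⟩ : C(D, ℂ))
  have hG' : ∀ z ∈ D, G (h z) = z := fun z hz => congrFun hG ⟨z, hz⟩
  have hGc : ContinuousAt G (h 0) := G.continuous.continuousAt
  obtain ⟨η, hη, hηG⟩ := Metric.continuousAt_iff.mp hGc 1 one_pos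
  rw [hG' 0 h0D] at hηG
  -- Half of `η`, so that the `ε`-ball around `c` stays where ‖G‖ < 1 and hence misses the image of
  -- the unit circle.
  set ε := η / 2
  have hε : 0 < ε := by positivity
  obtain ⟨c, hcb, hcX⟩ : ∃ c ∈ Metric.ball (h 0) ε, c ∉ X := by
    by_contra! hcon
    exact hX (Filter.mem_of_superset (Metric.ball_mem_nhds _ hε) hcon)
  have hXb : IsCompact (X \ Metric.ball c ε) := hXc.diff Metric.isOpen_ball
  obtain ⟨δ, hδ, hδ1, hδG⟩ : ∃ δ > 0, δ ≤ 1 ∧ ∀ y ∈ X \ Metric.ball c ε, δ ≤ ‖G y‖ := by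
    rcases (X \ Metric.ball c ε).eq_empty_or_nonempty with he | hne
    · exact ⟨1, one_pos, le_rfl, by simp [he]⟩
    · obtain ⟨y, hy, hmin⟩ := hXb.exists_isMinOn hne (G.continuous.norm.continuousOn)
      refine ⟨min 1 ‖G y‖, lt_min one_pos ?_, min_le_left _ _, fun x hx =>
        (min_le_right _ _).trans (hmin hx)⟩
      obtain ⟨⟨z, hz, rfl⟩, hy2⟩ := hy
      rw [hG' z hz, norm_pos_iff]
      rintro rfl
      exact hy2 (by rwa [Metric.mem_ball, dist_comm])
  have hKc : IsCompact (X ∪ Metric.closedBall c ε) := hXc.union (isCompact_closedBall c ε)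
  obtain ⟨Q, hQ, hQG⟩ : ∃ Q : ℂ → ℂ, ContDiff ℝ 1 Q ∧
      ∀ y ∈ X ∪ Metric.closedBall c ε, ‖Q y - G y‖ < δ / 2 := by
    have hd := ContinuousMap.dense_setOfPred_contDiff (E := ℂ) (F := ℂ) G
    rw [mem_closure_iff_nhds_basis (nhds_basis_uniformity
      Metric.uniformity_basis_dist.compactConvergenceUniformity)] at hd
    obtain ⟨Q, hQ, hQ2⟩ := hd ⟨_, δ / 2⟩ ⟨hKc, half_pos hδ⟩
    refine ⟨Q, (show ContDiff ℝ ((⊤ : ℕ∞) : WithTop ℕ∞) Q from hQ).of_le (by exact_mod_cast le_top), fun y hy => ?_⟩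
    have := hQ2 y hy
    rw [← dist_eq_norm]
    simpa [dist_comm] using this
  let κ : ℝ → ℂ := fun t => Q (c + ε * Complex.exp (t * Complex.I))
  have hκ : ContDiff ℝ 1 κ := by
    refine hQ.comp (contDiff_const.add (contDiff_const.mul ?_))
    exact ContDiff.cexp (Complex.ofRealCLM.contDiff.mul contDiff_const)
  -- A `C¹` curve has dense complement in the plane, so a small shift `s` makes `Q - s` zero-free on
  -- the circle of radius `ε` around `c`.
  have hdense := hκ.dense_compl_range_of_finrank_lt_finrank (by simp)
  obtain ⟨s, hs, hsδ⟩ := Metric.dense_iff.mp hdense 0 (δ / 2) (half_pos hδ)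
  rw [mem_ball_zero_iff] at hs
  let P : ℂ → ℂ := fun y => Q y - s
  have hP : Continuous P := hQ.continuous.sub continuous_const
  have hPG : ∀ y ∈ X ∪ Metric.closedBall c ε, ‖P y - G y‖ < δ := fun y hy => by
    have : P y - G y = (Q y - G y) - s := by simp only [P]; ring
    rw [this]
    linarith [norm_sub_le (Q y - G y) s, hQG y hy]
  -- Radial push from `c`: it fixes points at distance at least `ε` and sends the nearer points
  -- other than `c` to the circle. It is continuous on `X` because `c ∉ X`.
  let Φ : ℂ → ℂ := fun y => c + ((max 1 (ε / ‖y - c‖) : ℝ) : ℂ) * (y - c)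
  let r : ℂ → ℂ := fun z => (((max 1 ‖z‖)⁻¹ : ℝ) : ℂ) * z
  have hm : ∀ z : ℂ, (0 : ℝ) < max 1 ‖z‖ := fun z => lt_max_of_lt_left one_pos
  have hr : Continuous r := by
    refine (Complex.continuous_ofReal.comp ?_).mul continuous_id
    exact (continuous_const.max continuous_norm).inv₀ (fun z => (hm z).ne')
  have hrD : ∀ z, r z ∈ D := fun z => by
    simp only [D, mem_closedBall_zero_iff, r, norm_mul, Complex.norm_real, norm_inv, Real.norm_eq_abs,
      abs_of_pos (hm z)]
    rw [inv_mul_le_iff₀ (hm z), mul_one]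
    exact le_max_right _ _
  have hhr : Continuous (fun z => h (r z)) := hc.comp_continuous hr hrD
  have hhrX : ∀ z, h (r z) ∈ X := fun z => mem_image_of_mem _ (hrD z)
  have hnc : ∀ y ∈ X, 0 < ‖y - c‖ := fun y hy => by
    rw [norm_pos_iff, sub_ne_zero]; rintro rfl; exact hcX hy
  have hΦfar : ∀ y ∈ X, ε ≤ ‖y - c‖ → Φ y = y := fun y hy hyc => by
    have : ε / ‖y - c‖ ≤ 1 := by rw [div_le_one (hnc y hy)]; exact hyc
    simp only [Φ]; rw [max_eq_left this]; simp
  have hΦnear : ∀ y ∈ X, ‖y - c‖ < ε → Φ y = c + ε * Complex.exp ((y - c).arg * Complex.I) :=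
      fun y hy hyc => by
    have h1 : 1 ≤ ε / ‖y - c‖ := by rw [one_le_div (hnc y hy)]; exact hyc.le
    simp only [Φ]; rw [max_eq_right h1]
    have h2 := Complex.norm_mul_exp_arg_mul_I (y - c)
    have : (‖y - c‖ : ℂ) ≠ 0 := by exact_mod_cast (hnc y hy).ne'
    push_cast
    have h3 : Complex.exp ((y - c).arg * Complex.I) = (y - c) / ‖y - c‖ := by
      rw [eq_div_iff this, mul_comm]; exact h2
    rw [h3]
    ring
  refine not_exists_ne_zero_near_id_on_circle (fun z => P (Φ (h (r z)))) ?_ ?_ ?_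
  · refine hP.comp ?_
    refine continuous_const.add ((Complex.continuous_ofReal.comp ?_).mul (hhr.sub continuous_const))
    refine continuous_const.max (continuous_const.div (hhr.sub continuous_const).norm ?_)
    intro z
    exact (hnc _ (hhrX z)).ne'
  · intro z hz
    rcases le_or_gt ε ‖h (r z) - c‖ with hge | hlt
    · rw [hΦfar _ (hhrX z) hge] at hz
      have h1 := hPG _ (Or.inl (hhrX z))
      rw [hz, zero_sub, norm_neg] at h1
      have h2 := hδG (h (r z)) ⟨hhrX z, by simpa [dist_eq_norm] using hge⟩
      linarith
    · rw [hΦnear _ (hhrX z) hlt] at hz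
      exact hsδ ⟨_, sub_eq_zero.mp hz⟩
  · intro z hz
    have hzD : z ∈ D := by simp [D, hz]
    have hrz : r z = z := by simp [r, hz]
    have hfar : ε ≤ ‖h z - c‖ := by
      by_contra! hlt
      have hd : dist (h z) (h 0) < η := by
        have h1 : dist c (h 0) < ε := hcb
        have h2 : dist (h z) c < ε := by rwa [dist_eq_norm]
        have : η = ε + ε := by simp [ε]
        linarith [dist_triangle (h z) c (h 0)]
      have h3 := hηG hd
      rw [hG' z hzD, dist_zero_right, hz] at h3
      exact lt_irrefl _ h3
    simp only [hrz]
    rw [hΦfar _ (mem_image_of_mem _ hzD) hfar]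
    have := hPG (h z) (Or.inl (mem_image_of_mem _ hzD))
    rw [hG' z hzD] at this
    linarith

/-- Invariance of domain in dimension two. -/
theorem image_mem_nhds_of_injOn_of_finrank_eq_two {E F : Type*} [NormedAddCommGroup E]
    [NormedSpace ℝ E] [NormedAddCommGroup F] [NormedSpace ℝ F] (hE : Module.finrank ℝ E = 2)
    (hF : Module.finrank ℝ F = 2) {O : Set E} (hO : IsOpen O) {φ : E → F} (hc : ContinuousOn φ O)
    (hi : InjOn φ O) {v : E} (hv : v ∈ O) : φ '' O ∈ 𝓝 (φ v) := by
  have : FiniteDimensional ℝ E := Module.finite_of_finrank_pos (by omega)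
  have : FiniteDimensional ℝ F := Module.finite_of_finrank_pos (by omega)
  let eE : ℂ ≃L[ℝ] E := ContinuousLinearEquiv.ofFinrankEq (by rw [hE, Complex.finrank_real_complex])
  let eF : F ≃L[ℝ] ℂ := ContinuousLinearEquiv.ofFinrankEq (by rw [hF, Complex.finrank_real_complex])
  let g : ℂ → E := fun w => v + eE w
  have hg : Continuous g := by fun_prop
  have hg0 : g 0 = v := by simp [g]
  obtain ⟨ρ, hρ, hρO⟩ := Metric.nhds_basis_closedBall.mem_iff.mp
    (hg.continuousAt.preimage_mem_nhds (by rw [hg0]; exact hO.mem_nhds hv) : g ⁻¹' O ∈ 𝓝 0)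
  let s : ℂ → E := fun w => g (ρ * w)
  have hs : Continuous s := by fun_prop
  have hsO : MapsTo s (Metric.closedBall 0 1) O := fun w hw => hρO <| by
    rw [mem_closedBall_zero_iff] at hw ⊢
    rw [norm_mul, Complex.norm_real, Real.norm_of_nonneg hρ.le]
    nlinarith
  have hsi : Function.Injective s := fun a b hab => by
    have h1 : (ρ : ℂ) * a = ρ * b := eE.injective (add_left_cancel hab)
    exact mul_left_cancel₀ (by exact_mod_cast hρ.ne') h1
  have key := image_closedBall_mem_nhds_of_injOn (fun w => eF (φ (s w)))
    (eF.continuous.comp_continuousOn (hc.comp hs.continuousOn hsO))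
    (fun a ha b hb hab => hsi (hi (hsO ha) (hsO hb) (eF.injective hab)))
  have hs0 : s 0 = v := by simp [s, g]
  have h2 := eF.continuous.continuousAt.preimage_mem_nhds (x := φ v) (by simpa [hs0] using key)
  refine Filter.mem_of_superset h2 ?_
  rintro y ⟨w, hw, hwy⟩
  exact ⟨s w, hsO hw, eF.injective hwy⟩

/-! ### Local-to-global principle for convexity. -/

section LocalToGlobalConvexity

theorem segment_subset_union_of_mem {E : Type*} [AddCommGroup E] [Module ℝ E] {a b m : E}
    (hm : m ∈ segment ℝ a b) : segment ℝ a b ⊆ segment ℝ a m ∪ segment ℝ m b := by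
  rw [segment_eq_image_lineMap] at hm
  obtain ⟨s, hs, rfl⟩ := hm
  have key : ∀ x y : ℝ, x ≤ y → segment ℝ (AffineMap.lineMap a b x) (AffineMap.lineMap a b y) =
      (AffineMap.lineMap a b : ℝ →ᵃ[ℝ] E) '' Icc x y := fun x y hxy => by
    rw [← segment_eq_Icc hxy, image_segment]
  have h1 := key 0 1 zero_le_one
  have h2 := key 0 s hs.1
  have h3 := key s 1 hs.2
  simp only [AffineMap.lineMap_apply_zero, AffineMap.lineMap_apply_one] at h1 h2 h3
  rw [h1, h2, h3, ← image_union, Icc_union_Icc_eq_Icc hs.1 hs.2]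

variable {X E ι : Type*} [TopologicalSpace X] [NormedAddCommGroup E]

/-- Points of a common patch with images at distance at most `ε`. -/
def PatchNear (f : X → E) (P : ι → Set X) (ε : ℝ) (a b : X) : Prop :=
  ∃ j, a ∈ P j ∧ b ∈ P j ∧ ‖f a - f b‖ ≤ ε

theorem PatchNear.symm {X E ι : Type*} [NormedAddCommGroup E] {f : X → E} {P : ι → Set X} {ε : ℝ} {a b : X} (h : PatchNear f P ε a b) :
    PatchNear f P ε b a := by
  obtain ⟨j, ha, hb, hab⟩ := h
  exact ⟨j, hb, ha, by rwa [norm_sub_rev]⟩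

theorem isClosed_patchNear [Finite ι] {f : X → E} (hf : Continuous f) {P : ι → Set X}
    (hP : ∀ j, IsClosed (P j)) (ε : ℝ) : IsClosed {x : X × X | PatchNear f P ε x.1 x.2} := by
  have : {x : X × X | PatchNear f P ε x.1 x.2} =
      ⋃ j, {x : X × X | x.1 ∈ P j ∧ x.2 ∈ P j ∧ ‖f x.1 - f x.2‖ ≤ ε} := by
    ext x; simp [PatchNear]
  rw [this]
  refine isClosed_iUnion_of_finite fun j => ?_
  refine ((hP j).preimage continuous_fst).inter (((hP j).preimage continuous_snd).inter ?_)
  exact isClosed_le ((hf.comp continuous_fst).sub (hf.comp continuous_snd)).norm continuous_const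

/-- A Lebesgue number argument. The triples with patches for both pairs but no common patch interior
form a compact set. On it the larger of the two image distances is positive, since a zero would make
all three points equal, and so it is bounded below. -/
theorem exists_patchNear_common_patch [CompactSpace X] [Finite ι] {f : X → E}
    (hf : Continuous f) {P : ι → Set X} (hP : ∀ j, IsClosed (P j)) (hinj : ∀ j, InjOn f (P j))
    (hcov : ∀ x, ∃ j, x ∈ interior (P j)) :
    ∃ ε > 0, ∀ a b c, PatchNear f P ε a b → PatchNear f P ε b c →
      ∃ j, a ∈ P j ∧ b ∈ P j ∧ c ∈ P j := by
  let Z : Set (X × X × X) := {t | (∃ j, t.1 ∈ P j ∧ t.2.1 ∈ P j) ∧ (∃ j, t.2.1 ∈ P j ∧ t.2.2 ∈ P j) ∧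
    ∀ j, ¬ (t.1 ∈ interior (P j) ∧ t.2.1 ∈ interior (P j) ∧ t.2.2 ∈ interior (P j))}
  have hZ : IsCompact Z := by
    apply IsClosed.isCompact
    have h1 : IsClosed {t : X × X × X | ∃ j, t.1 ∈ P j ∧ t.2.1 ∈ P j} := by
      rw [ofPred_exists]
      exact isClosed_iUnion_of_finite fun j => ((hP j).preimage continuous_fst).inter
        ((hP j).preimage (continuous_fst.comp continuous_snd))
    have h2 : IsClosed {t : X × X × X | ∃ j, t.2.1 ∈ P j ∧ t.2.2 ∈ P j} := by
      rw [ofPred_exists]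
      exact isClosed_iUnion_of_finite fun j =>
        ((hP j).preimage (continuous_fst.comp continuous_snd)).inter
        ((hP j).preimage (continuous_snd.comp continuous_snd))
    have h3 : IsClosed {t : X × X × X | ∀ j, ¬ (t.1 ∈ interior (P j) ∧ t.2.1 ∈ interior (P j) ∧
        t.2.2 ∈ interior (P j))} := by
      rw [ofPred_forall]
      refine isClosed_iInter fun j => isOpen_compl_iff.mp ?_
      have : IsOpen {t : X × X × X | t.1 ∈ interior (P j) ∧ t.2.1 ∈ interior (P j) ∧
        t.2.2 ∈ interior (P j)} := (isOpen_interior.preimage continuous_fst).inter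
          ((isOpen_interior.preimage (continuous_fst.comp continuous_snd)).inter
          (isOpen_interior.preimage (continuous_snd.comp continuous_snd)))
      convert this using 1
      ext t; simp
    exact h1.inter (h2.inter h3)
  let φ : X × X × X → ℝ := fun t => max ‖f t.1 - f t.2.1‖ ‖f t.2.1 - f t.2.2‖
  have hφ : Continuous φ := by fun_prop
  have hpos : ∀ t ∈ Z, 0 < φ t := by
    rintro ⟨a, b, c⟩ ⟨⟨i, hai, hbi⟩, ⟨j, hbj, hcj⟩, hn⟩
    by_contra! hle
    obtain ⟨h1, h2⟩ := max_le_iff.mp hle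
    have hab : a = b := hinj i hai hbi (sub_eq_zero.mp (norm_le_zero_iff.mp h1))
    have hbc : b = c := hinj j hbj hcj (sub_eq_zero.mp (norm_le_zero_iff.mp h2))
    obtain ⟨k, hk⟩ := hcov a
    subst hab; subst hbc
    exact hn k ⟨hk, hk, hk⟩
  obtain ⟨ε, hε, hεZ⟩ : ∃ ε > 0, ∀ t ∈ Z, ε < φ t := by
    rcases Z.eq_empty_or_nonempty with he | hne
    · exact ⟨1, one_pos, by simp [he]⟩
    · obtain ⟨t, ht, hmin⟩ := hZ.exists_isMinOn hne hφ.continuousOn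
      exact ⟨φ t / 2, half_pos (hpos t ht), fun s hs =>
        (half_lt_self (hpos t ht)).trans_le (hmin hs)⟩
  refine ⟨ε, hε, fun a b c ⟨i, hai, hbi, hab⟩ ⟨j, hbj, hcj, hbc⟩ => ?_⟩
  by_contra! hcon
  refine (hεZ (a, b, c) ⟨⟨i, hai, hbi⟩, ⟨j, hbj, hcj⟩, fun k hk => ?_⟩).not_ge (max_le hab hbc)
  exact hcon k (interior_subset hk.1) (interior_subset hk.2.1) (interior_subset hk.2.2)

theorem exists_patchNear_chain [PreconnectedSpace X] {f : X → E} (hf : Continuous f)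
    {P : ι → Set X} (hcov : ∀ x, ∃ j, x ∈ interior (P j)) {ε : ℝ} (hε : 0 < ε) (x y : X) :
    ∃ (N : ℕ) (u : ℕ → X), u 0 = x ∧ u N = y ∧ ∀ i < N, PatchNear f P ε (u i) (u (i + 1)) := by
  let C : Set X := {z | ∃ (N : ℕ) (u : ℕ → X), u 0 = x ∧ u N = z ∧
    ∀ i < N, PatchNear f P ε (u i) (u (i + 1))}
  have hstep : ∀ a ∈ C, ∀ b, PatchNear f P ε a b → b ∈ C := by
    rintro a ⟨N, u, h0, hN, hu⟩ b hab
    refine ⟨N + 1, fun i => if i ≤ N then u i else b, by simp [h0], by simp, fun i hi => ?_⟩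
    rcases Nat.lt_succ_iff_lt_or_eq.mp hi with h | h
    · simp only [h.le, if_true, Nat.succ_le_of_lt h]; exact hu i h
    · subst h; simpa [hN] using hab
  have hnear : ∀ a, ∀ᶠ b in 𝓝 a, PatchNear f P ε a b := fun a => by
    obtain ⟨j, hj⟩ := hcov a
    have h1 : ∀ᶠ b in 𝓝 a, ‖f a - f b‖ < ε := by
      have : Filter.Tendsto (fun b => ‖f a - f b‖) (𝓝 a) (𝓝 ‖f a - f a‖) :=
        (continuous_const.sub hf).norm.tendsto a
      rw [sub_self, norm_zero] at this
      exact this.eventually_lt_const hε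
    filter_upwards [h1, isOpen_interior.mem_nhds hj] with b hb hbj
    exact ⟨j, interior_subset hj, interior_subset hbj, hb.le⟩
  have hC : IsClopen C := by
    refine ⟨?_, ?_⟩
    · rw [← isOpen_compl_iff, isOpen_iff_mem_nhds]
      intro a ha
      filter_upwards [hnear a] with b hb hbC
      exact ha (hstep b hbC a hb.symm)
    · rw [isOpen_iff_mem_nhds]
      intro a ha
      filter_upwards [hnear a] with b hb
      exact hstep a ha b hb
  have : y ∈ C := by
    rw [hC.eq_univ ⟨x, 0, fun _ => x, rfl, rfl, by simp⟩]; trivial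
  exact this


end LocalToGlobalConvexity

theorem norm_sub_midpoint_sq_add {E : Type*} [NormedAddCommGroup E] [InnerProductSpace ℝ E] (a b c : E) :
    ‖a - (1 / 2 : ℝ) • (a + c)‖ ^ 2 + ‖(1 / 2 : ℝ) • (a + c) - c‖ ^ 2
      + 2 * ‖b - (1 / 2 : ℝ) • (a + c)‖ ^ 2 = ‖a - b‖ ^ 2 + ‖b - c‖ ^ 2 := by
  have h1 : a - (1 / 2 : ℝ) • (a + c) = (1 / 2 : ℝ) • ((a - b) + (b - c)) := by module
  have h2 : (1 / 2 : ℝ) • (a + c) - c = (1 / 2 : ℝ) • ((a - b) + (b - c)) := by module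
  have h3 : b - (1 / 2 : ℝ) • (a + c) = (1 / 2 : ℝ) • ((b - c) - (a - b)) := by module
  rw [h1, h2, h3]
  generalize a - b = x
  generalize b - c = y
  simp only [norm_smul, mul_pow, norm_add_sq_real, norm_sub_sq_real, real_inner_comm x y]
  norm_num
  ring

section LocalToGlobalConvexity

variable {X E ι : Type*} [TopologicalSpace X] [NormedAddCommGroup E] [InnerProductSpace ℝ E]

/-- Along an energy minimizing chain, consecutive images are equally spaced on a line. -/
theorem exists_equally_spaced_patchNear_chain [CompactSpace X] [T2Space X] [PreconnectedSpace X]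
    [Finite ι] {f : X → E} (hf : Continuous f) {P : ι → Set X} (hP : ∀ j, IsClosed (P j))
    (hinj : ∀ j, InjOn f (P j)) (hconv : ∀ j, Convex ℝ (f '' P j))
    (hcov : ∀ x, ∃ j, x ∈ interior (P j)) (x y : X) :
    ∃ (N : ℕ) (u : ℕ → X) (v : E), u 0 = x ∧ u N = y ∧
      (∀ i < N, ∃ j, u i ∈ P j ∧ u (i + 1) ∈ P j) ∧ ∀ i < N, f (u (i + 1)) = f (u i) + v := by
  obtain ⟨ε, hε, hcommon⟩ := exists_patchNear_common_patch hf hP hinj hcov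
  obtain ⟨N, u₀, hu0, huN, hu⟩ := exists_patchNear_chain hf hcov hε x y
  let C : Set (ℕ → X) := {u | u 0 = x ∧ u N = y ∧ ∀ i < N, PatchNear f P ε (u i) (u (i + 1))}
  have hC : IsCompact C := by
    apply IsClosed.isCompact
    refine (isClosed_eq (continuous_apply 0) continuous_const).inter
      ((isClosed_eq (continuous_apply N) continuous_const).inter ?_)
    change IsClosed {u : ℕ → X | ∀ i < N, PatchNear f P ε (u i) (u (i + 1))}
    simp only [ofPred_forall]
    refine isClosed_iInter fun i => isClosed_iInter fun _ => ?_
    have hcont : Continuous fun u : ℕ → X => (u i, u (i + 1)) := by fun_prop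
    exact IsClosed.preimage hcont (isClosed_patchNear hf hP ε)
  let en : (ℕ → X) → ℝ := fun u => ∑ i ∈ Finset.range N, ‖f (u i) - f (u (i + 1))‖ ^ 2
  have hen : Continuous en := by
    refine continuous_finsetSum _ fun i _ => ?_
    exact ((hf.comp (continuous_apply i)).sub (hf.comp (continuous_apply (i + 1)))).norm.pow 2
  obtain ⟨u, ⟨h0, hN, hR⟩, hmin⟩ := hC.exists_isMinOn ⟨u₀, hu0, huN, hu⟩ hen.continuousOn
  have hmid : ∀ k, k + 1 < N → f (u (k + 1)) = (1 / 2 : ℝ) • (f (u k) + f (u (k + 2))) := by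
    -- Replacing the middle of three consecutive vertices by the preimage of the midpoint of its
    -- neighbors gives an admissible chain: all three lie in one convex patch, and the new steps are
    -- half of at most 2ε. Minimality then forces the vertex to be at the midpoint already.
    intro k hk
    obtain ⟨j, ha, hb, hc⟩ := hcommon _ _ _ (hR k (by omega)) (hR (k + 1) hk)
    obtain ⟨m, hm, hfm⟩ : (1 / 2 : ℝ) • (f (u k) + f (u (k + 2))) ∈ f '' P j := by
      rw [smul_add]
      exact hconv j (mem_image_of_mem f ha) (mem_image_of_mem f hc) (by norm_num) (by norm_num)
        (by norm_num)
    obtain ⟨-, -, -, hab⟩ := hR k (by omega)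
    obtain ⟨-, -, -, hbc⟩ := hR (k + 1) hk
    have hac : ‖f (u k) - f (u (k + 2))‖ ≤ 2 * ε := by
      have := norm_sub_le_norm_sub_add_norm_sub (f (u k)) (f (u (k + 1))) (f (u (k + 2)))
      linarith
    have ham : ‖f (u k) - f m‖ ≤ ε := by
      have : f (u k) - f m = (1 / 2 : ℝ) • (f (u k) - f (u (k + 2))) := by rw [hfm]; module
      rw [this, norm_smul]; norm_num; linarith
    have hmc : ‖f m - f (u (k + 2))‖ ≤ ε := by
      have : f m - f (u (k + 2)) = (1 / 2 : ℝ) • (f (u k) - f (u (k + 2))) := by rw [hfm]; module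
      rw [this, norm_smul]; norm_num; linarith
    let w := Function.update u (k + 1) m
    have hwk : w (k + 1) = m := Function.update_self ..
    have hwne : ∀ i, i ≠ k + 1 → w i = u i := fun i hi => Function.update_of_ne hi ..
    have hwC : w ∈ C := by
      refine ⟨by rw [hwne _ (by omega), h0], by rw [hwne _ (by omega), hN], fun i hi => ?_⟩
      by_cases h1 : i = k
      · subst h1; rw [hwne i (by omega), hwk]; exact ⟨j, ha, hm, ham⟩
      by_cases h2 : i = k + 1
      · subst h2; rw [hwne (k + 1 + 1) (by omega), hwk]; exact ⟨j, hm, hc, hmc⟩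
      rw [hwne i h2, hwne (i + 1) (by omega)]
      exact hR i hi
    have hle : en u ≤ en w := hmin hwC
    have hsplit : ∀ z : ℕ → X, en z = ‖f (z k) - f (z (k + 1))‖ ^ 2
        + (‖f (z (k + 1)) - f (z (k + 2))‖ ^ 2
        + ∑ i ∈ ((Finset.range N).erase k).erase (k + 1), ‖f (z i) - f (z (i + 1))‖ ^ 2) := fun z => by
      rw [Finset.add_sum_erase _ (fun i => ‖f (z i) - f (z (i + 1))‖ ^ 2)
        (by simp; omega : k + 1 ∈ (Finset.range N).erase k),
        Finset.add_sum_erase _ (fun i => ‖f (z i) - f (z (i + 1))‖ ^ 2) (by simp; omega)]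
    rw [hsplit u, hsplit w, hwk, hwne k (by omega), hwne (k + 2) (by omega)] at hle
    have hsum : ∑ i ∈ ((Finset.range N).erase k).erase (k + 1), ‖f (w i) - f (w (i + 1))‖ ^ 2
        = ∑ i ∈ ((Finset.range N).erase k).erase (k + 1), ‖f (u i) - f (u (i + 1))‖ ^ 2 := by
      refine Finset.sum_congr rfl fun i hi => ?_
      simp only [Finset.mem_erase, Finset.mem_range] at hi
      rw [hwne i (by omega), hwne (i + 1) (by omega)]
    rw [hsum, hfm] at hle
    have hid := norm_sub_midpoint_sq_add (f (u k)) (f (u (k + 1))) (f (u (k + 2)))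
    have hz : ‖f (u (k + 1)) - (1 / 2 : ℝ) • (f (u k) + f (u (k + 2)))‖ ^ 2 ≤ 0 := by linarith
    exact sub_eq_zero.mp (norm_eq_zero.mp (pow_eq_zero_iff two_ne_zero |>.mp
      (le_antisymm hz (sq_nonneg _))))
  refine ⟨N, u, f (u 1) - f (u 0), h0, hN, fun i hi => ?_, fun i => ?_⟩
  · obtain ⟨j, hj1, hj2, -⟩ := hR i hi
    exact ⟨j, hj1, hj2⟩
  · induction i with
    | zero => intro _; simp
    | succ k ih =>
      intro hk
      have h1 := ih (by omega)
      have h2 := hmid k hk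
      have h3 : f (u (k + 2)) = (2 : ℝ) • f (u (k + 1)) - f (u k) := by rw [h2]; module
      change f (u (k + 2)) = _
      rw [h3]
      nth_rewrite 1 [two_smul, h1]
      rw [h1]
      abel

/-- Local-to-global principle for convexity: a continuous map on a compact connected space which is
locally an embedding onto a convex set is injective with convex image. -/
theorem injective_and_convex_range_of_local [CompactSpace X] [T2Space X] [PreconnectedSpace X]
    {f : X → E} (hf : Continuous f)
    (hloc : ∀ x, ∃ P ∈ 𝓝 x, IsClosed P ∧ InjOn f P ∧ Convex ℝ (f '' P)) :
    Function.Injective f ∧ Convex ℝ (range f) := by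
  choose Q hQn hQc hQi hQv using hloc
  obtain ⟨t, -, ht⟩ := isCompact_univ.elim_nhds_subcover (fun x => interior (Q x))
    (fun x _ => interior_mem_nhds.mpr (hQn x))
  have hcov : ∀ x, ∃ j : t, x ∈ interior (Q j) := fun x => by
    have := ht (mem_univ x)
    simp only [mem_iUnion] at this
    obtain ⟨j, hj, hx⟩ := this
    exact ⟨⟨j, hj⟩, hx⟩
  have key := exists_equally_spaced_patchNear_chain (P := fun j : t => Q j) hf
    (fun j => hQc _) (fun j => hQi _) (fun j => hQv _) hcov
  have hlin : ∀ {N : ℕ} {u : ℕ → X} {v : E}, (∀ i < N, f (u (i + 1)) = f (u i) + v) →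
      ∀ i ≤ N, f (u i) = f (u 0) + (i : ℝ) • v := fun {N u v} h i => by
    induction i with
    | zero => simp
    | succ k ih =>
      intro hk
      rw [h k hk, ih (by omega)]
      push_cast
      module
  constructor
  · intro x y hxy
    -- Equally spaced images that return to their start do not move, and injectivity on the patches
    -- makes the chain itself constant.
    obtain ⟨N, u, v, h0, hN, hpatch, hstep⟩ := key x y
    have hv : (N : ℝ) • v = 0 := by
      have := hlin hstep N le_rfl
      rw [h0, hN, hxy] at this
      exact left_eq_add.mp this
    have hall : ∀ i ≤ N, u i = u 0 := fun i => by
      induction i with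
      | zero => simp
      | succ k ih =>
        intro hk
        rw [← ih (by omega)]
        obtain ⟨j, hj1, hj2⟩ := hpatch k hk
        refine hQi _ hj2 hj1 ?_
        have hN0 : (N : ℝ) ≠ 0 := by
          have : N ≠ 0 := by omega
          exact_mod_cast this
        rw [hstep k hk, (smul_eq_zero.mp hv).resolve_left hN0, add_zero]
    rw [← h0, ← hN, hall N le_rfl]
  · rw [convex_iff_segment_subset]
    rintro _ ⟨x, rfl⟩ _ ⟨y, rfl⟩
    obtain ⟨N, u, v, h0, hN, hpatch, hstep⟩ := key x y
    -- The straight segment is assembled from the steps of the chain, each inside the convex image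
    -- of a patch.
    have hseg : ∀ i ≤ N, segment ℝ (f (u 0)) (f (u i)) ⊆ range f := fun i => by
      induction i with
      | zero =>
        intro _
        rw [segment_same]
        rintro _ rfl
        exact mem_range_self _
      | succ k ih =>
        intro hk
        have h1 : f (u k) ∈ segment ℝ (f (u 0)) (f (u (k + 1))) := by
          refine ⟨1 / (k + 1), k / (k + 1), by positivity, by positivity, ?_, ?_⟩
          · field_simp; ring
          · rw [hlin hstep (k + 1) hk, hlin hstep k (by omega)]
            push_cast
            have : (k + 1 : ℝ) ≠ 0 := by positivity
            rw [smul_add, smul_smul, ← add_assoc, ← add_smul, div_mul_cancel₀ _ this,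
              ← add_div, add_comm (1 : ℝ), div_self this, one_smul]
        obtain ⟨j, hj1, hj2⟩ := hpatch k hk
        have h3 : segment ℝ (f (u k)) (f (u (k + 1))) ⊆ range f :=
          ((hQv _).segment_subset (mem_image_of_mem f hj1) (mem_image_of_mem f hj2)).trans
            (image_subset_range _ _)
        exact (segment_subset_union_of_mem h1).trans (union_subset (ih (by omega)) h3)
    rw [← h0, ← hN]
    exact hseg N le_rfl

end LocalToGlobalConvexity

/-! ### Central projection of convex boundaries and support planes. -/

section CentralProjection

variable {E : Type*} [NormedAddCommGroup E] [InnerProductSpace ℝ E]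

/-- Projection from the point `z` to the hyperplane `⟪n, x⟫ = c`. -/
noncomputable def centralProjection (n : E) (c : ℝ) (z y : E) : E :=
  z + ((c - inner ℝ n z) / inner ℝ n (y - z)) • (y - z)

/-- The open half-space bounded by the parallel through `z` to the hyperplane `⟪n, x⟫ = c` which
contains this hyperplane. -/
def visibleHalfSpace (n : E) (c : ℝ) (z : E) : Set E :=
  {y | 0 < (c - inner ℝ n z) * inner ℝ n (y - z)}

variable {n : E} {c : ℝ} {z : E}

theorem isOpen_visibleHalfSpace : IsOpen (visibleHalfSpace n c z) :=
  isOpen_lt continuous_const (by fun_prop)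

theorem mem_visibleHalfSpace (hz : inner ℝ n z ≠ c) {x : E} (hx : inner ℝ n x = c) :
    x ∈ visibleHalfSpace n c z := by
  have : c - inner ℝ n z ≠ 0 := sub_ne_zero.mpr hz.symm
  simp only [visibleHalfSpace, mem_ofPred_eq, inner_sub_right, hx]
  exact mul_self_pos.mpr this

theorem continuousOn_centralProjection :
    ContinuousOn (centralProjection n c z) (visibleHalfSpace n c z) := by
  refine continuousOn_const.add (ContinuousOn.smul (continuousOn_const.div (by fun_prop) ?_)
    (by fun_prop))
  intro y hy h0
  simp [visibleHalfSpace, h0] at hy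

theorem inner_centralProjection {y : E} (hy : y ∈ visibleHalfSpace n c z) :
    inner ℝ n (centralProjection n c z y) = c := by
  have h0 : inner ℝ n (y - z) ≠ 0 := fun h0 => by simp [visibleHalfSpace, h0] at hy
  rw [centralProjection, inner_add_right, inner_smul_right, div_mul_cancel₀ _ h0]
  ring

theorem centralProjection_eq_self (hz : inner ℝ n z ≠ c) {x : E} (hx : inner ℝ n x = c) :
    centralProjection n c z x = x := by
  have : c - inner ℝ n z ≠ 0 := sub_ne_zero.mpr hz.symm
  rw [centralProjection, inner_sub_right, hx, div_self this]
  simp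

/-- A ray from an interior point meets the boundary of a convex set at most once. The half-space
restriction ensures that points with equal projections lie on the same ray, not on opposite ones. -/
theorem injOn_centralProjection {K : Set E} (hK : Convex ℝ K) (hzK : z ∈ interior K) :
    InjOn (centralProjection n c z) (frontier K ∩ visibleHalfSpace n c z) := by
  have key : ∀ y ∈ frontier K, ∀ y' ∈ frontier K, ∀ l : ℝ, 0 < l → y' - z = l • (y - z) →
      1 ≤ l := by
    intro y hy y' hy' l hl h
    by_contra! hl1
    refine hy'.2 (hK.openSegment_interior_closure_subset_interior hzK hy.1
      ⟨1 - l, l, by linarith, hl, by ring, ?_⟩)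
    rw [sub_eq_iff_eq_add.mp h]
    module
  rintro y ⟨hyK, hy⟩ y' ⟨hyK', hy'⟩ h
  simp only [visibleHalfSpace, mem_ofPred_eq] at hy hy'
  set s := c - inner ℝ n z
  set α := inner ℝ n (y - z)
  set β := inner ℝ n (y' - z)
  have hs : s ≠ 0 := fun h => by simp [h] at hy
  have hα : α ≠ 0 := fun h => by simp [h] at hy
  have hβ : β ≠ 0 := fun h => by simp [h] at hy'
  have h1 : (s / α) • (y - z) = (s / β) • (y' - z) := add_left_cancel h
  have hab : 0 < α * β := by
    have := mul_pos hy hy'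
    have h2 : 0 < s * s := mul_self_pos.mpr hs
    by_contra! hle
    nlinarith
  have hl : 0 < β / α := by
    rw [div_eq_mul_inv, show β * α⁻¹ = (α * β) * (α⁻¹ * α⁻¹) by field_simp]
    exact mul_pos hab (mul_self_pos.mpr (inv_ne_zero hα))
  have h2 : y' - z = (β / α) • (y - z) := by
    rw [show β / α = (β / s) * (s / α) by field_simp, mul_smul, h1, smul_smul,
      show (β / s) * (s / β) = 1 by field_simp, one_smul]
  have h3 : y - z = (β / α)⁻¹ • (y' - z) := by rw [h2, smul_smul, inv_mul_cancel₀ hl.ne', one_smul]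
  have h4 : β / α = 1 := le_antisymm ((one_le_inv₀ hl).mp (key _ hyK' _ hyK _ (inv_pos.mpr hl) h3))
    (key _ hyK _ hyK' _ hl h2)
  rw [h4, one_smul] at h2
  exact (sub_left_inj.mp h2).symm

theorem tendsto_centralProjection (hz : inner ℝ n z ≠ c) {x : E} (hx : inner ℝ n x = c) :
    Filter.Tendsto (centralProjection n c z) (𝓝 x) (𝓝 x) := by
  have h := (continuousOn_centralProjection (n := n) (c := c) (z := z)).continuousAt
    (isOpen_visibleHalfSpace.mem_nhds (mem_visibleHalfSpace hz hx))
  rwa [ContinuousAt, centralProjection_eq_self hz hx] at h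

/-- If the boundary of a convex set contains a piece of a hyperplane which misses an interior point,
then near the points of that piece the boundary lies in the hyperplane. -/
theorem eventually_mem_hyperplane_of_mem_frontier {K : Set E} (hK : Convex ℝ K)
    (hzK : z ∈ interior K) (hz : inner ℝ n z ≠ c) {x : E} (hx : inner ℝ n x = c)
    (hflat : ∀ᶠ y in 𝓝 x, inner ℝ n y = c → y ∈ frontier K) :
    ∀ᶠ y in 𝓝 x, y ∈ frontier K → inner ℝ n y = c := by
  have hW := isOpen_visibleHalfSpace.mem_nhds (mem_visibleHalfSpace hz hx)
  filter_upwards [hW, (tendsto_centralProjection hz hx).eventually hflat,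
    (tendsto_centralProjection hz hx).eventually hW] with y hyW hyF hyW' hyK
  have h1 := inner_centralProjection hyW
  have h2 := injOn_centralProjection hK hzK ⟨hyF h1, hyW'⟩ ⟨hyK, hyW⟩
    (centralProjection_eq_self hz h1)
  rwa [← h2]

/-- A local support hyperplane of the boundary of a closed convex set misses the interior. -/
theorem inner_ne_of_locally_supporting {K : Set E} (hK : Convex ℝ K) (hKc : IsClosed K) (hn : n ≠ 0)
    {x : E} (hxK : x ∈ frontier K) (hx : inner ℝ n x = c)
    (hsup : ∀ᶠ y in 𝓝 x, y ∈ frontier K → inner ℝ n y ≤ c) :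
    ∀ z ∈ interior K, inner ℝ n z ≠ c := by
  intro z hzK hz
  obtain ⟨r, hr, hball⟩ := Metric.eventually_nhds_iff_ball.mp hsup
  have hlim : ∀ v : E, Filter.Tendsto (fun t : ℝ => x + t • v) (𝓝[>] 0) (𝓝 x) := fun v => by
    have : Filter.Tendsto (fun t : ℝ => x + t • v) (𝓝 0) (𝓝 (x + (0 : ℝ) • v)) :=
      Continuous.tendsto (by fun_prop) 0
    rw [zero_smul, add_zero] at this
    exact this.mono_left nhdsWithin_le_nhds
  have hxcl : x ∈ closure K := hxK.1
  obtain ⟨t, ⟨ht0, ht1⟩, htb⟩ := (Filter.Eventually.and (Ioo_mem_nhdsGT (zero_lt_one (α := ℝ)))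
    ((hlim (z - x)).eventually (Metric.ball_mem_nhds x hr)) :
    ∀ᶠ t : ℝ in 𝓝[>] 0, t ∈ Ioo (0 : ℝ) 1 ∧ x + t • (z - x) ∈ Metric.ball x r).exists
  have hz' : x + t • (z - x) ∈ interior K :=
    hK.openSegment_interior_closure_subset_interior hzK hxcl
      ⟨t, 1 - t, ht0, by linarith, by ring, by module⟩
  set z' := x + t • (z - x)
  have hz'H : inner ℝ n z' = c := by
    simp only [z', inner_add_right, inner_smul_right, inner_sub_right, hx, hz]; ring
  have hlim2 : Filter.Tendsto (fun s : ℝ => z' + s • n) (𝓝[>] 0) (𝓝 z') := by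
    have : Filter.Tendsto (fun t : ℝ => z' + t • n) (𝓝 0) (𝓝 (z' + (0 : ℝ) • n)) :=
      Continuous.tendsto (by fun_prop) 0
    rw [zero_smul, add_zero] at this
    exact this.mono_left nhdsWithin_le_nhds
  obtain ⟨s, hs, hsK, hsb⟩ := (Filter.Eventually.and self_mem_nhdsWithin ((hlim2.eventually
    (isOpen_interior.mem_nhds hz')).and (hlim2.eventually (Metric.isOpen_ball.mem_nhds htb))) :
    ∀ᶠ s : ℝ in 𝓝[>] 0, s ∈ Ioi (0 : ℝ) ∧ z' + s • n ∈ interior K ∧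
      z' + s • n ∈ Metric.ball x r).exists
  set k := z' + s • n
  have hk : c < inner ℝ n k := by
    have h1 : 0 < inner ℝ n n := real_inner_self_pos.mpr hn
    have h2 : 0 < s := hs
    simp only [k, inner_add_right, inner_smul_right, hz'H]
    nlinarith
  -- Since `k` is an interior point strictly beyond the hyperplane, a segment from `k` to a point
  -- `y` outside `K` would cross the frontier strictly beyond it, inside the ball.
  have hin : ∀ y ∈ Metric.ball x r, c ≤ inner ℝ n y → y ∈ K := by
    intro y hyb hyc
    by_contra hyK
    obtain ⟨w, hw, hwK⟩ : ∃ w ∈ segment ℝ k y, w ∈ frontier K := by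
      by_contra! hcon
      obtain ⟨w, -, hw1, hw2⟩ := (convex_segment k y).isPreconnected (interior K) Kᶜ
        isOpen_interior hKc.isOpen_compl
        (fun w hw => (em (w ∈ K)).imp_left fun hwK => by
          by_contra hwi; exact hcon w hw ⟨subset_closure hwK, hwi⟩)
        ⟨k, left_mem_segment ℝ k y, hsK⟩ ⟨y, right_mem_segment ℝ k y, hyK⟩
      exact hw2 (interior_subset hw1)
    have hwb := (convex_ball x r).segment_subset hsb hyb hw
    have hle := hball w hwb hwK
    obtain ⟨a, b, ha, hb, hab, rfl⟩ := hw
    rcases ha.eq_or_lt with h0 | h0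
    · rw [← h0, zero_add] at hab
      rw [← h0, hab, zero_smul, zero_add, one_smul] at hwK
      exact hyK (hKc.frontier_subset hwK)
    · simp only [inner_add_right, inner_smul_right] at hle
      have h1 := mul_lt_mul_of_pos_left hk h0
      have h2 := mul_le_mul_of_nonneg_left hyc hb
      have h3 : a * c + b * c = c := by rw [← add_mul, hab, one_mul]
      linarith
  -- Continuing from `z` slightly past `x` stays in the hyperplane, hence in `K`; thus `x` is
  -- strictly between an interior point and a point of `K`, and so is interior.
  obtain ⟨τ, hτ, hτb⟩ := (Filter.Eventually.and self_mem_nhdsWithin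
    ((hlim (x - z)).eventually (Metric.ball_mem_nhds x hr)) :
    ∀ᶠ t : ℝ in 𝓝[>] 0, t ∈ Ioi (0 : ℝ) ∧ x + t • (x - z) ∈ Metric.ball x r).exists
  have hτ0 : 0 < τ := hτ
  have hy := hin _ hτb (by simp only [inner_add_right, inner_smul_right, inner_sub_right, hx, hz]; simp)
  refine hxK.2 (hK.openSegment_interior_closure_subset_interior hzK (subset_closure hy)
    ⟨τ / (1 + τ), 1 / (1 + τ), by positivity, by positivity, by field_simp; ring, ?_⟩)
  have h1 : (1 + τ) ≠ 0 := by positivity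
  have : (τ / (1 + τ)) • z + (1 / (1 + τ)) • (x + τ • (x - z))
      = ((1 + τ) / (1 + τ)) • x := by module
  rw [this, div_self h1, one_smul]

theorem inner_le_or_le_of_inner_ne {K : Set E} (hK : Convex ℝ K) (hKi : (interior K).Nonempty)
    (h : ∀ z ∈ interior K, inner ℝ n z ≠ c) :
    (∀ y ∈ K, inner ℝ n y ≤ c) ∨ ∀ y ∈ K, c ≤ inner ℝ n y := by
  obtain ⟨z, hz⟩ := hKi
  have key : ∀ y ∈ K, 0 ≤ (c - inner ℝ n z) * (c - inner ℝ n y) := by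
    intro y hy
    by_contra! hlt
    have hd : inner ℝ n y - inner ℝ n z ≠ 0 := fun h0 => by
      rw [sub_eq_zero.mp h0] at hlt
      nlinarith [mul_self_nonneg (c - inner ℝ n z)]
    set a := inner ℝ n z
    set b := inner ℝ n y
    have hpos : 0 < (c - a) / (b - a) ∧ (c - a) / (b - a) < 1 := by
      rcases lt_or_gt_of_ne hd with h0 | h0
      · have : c < a := by by_contra! h1; nlinarith
        have : b < c := by by_contra! h1; nlinarith
        exact ⟨div_pos_of_neg_of_neg (by linarith) h0, by rw [div_lt_one_of_neg h0]; linarith⟩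
      · have : a < c := by by_contra! h1; nlinarith
        have : c < b := by by_contra! h1; nlinarith
        exact ⟨div_pos (by linarith) h0, by rw [div_lt_one h0]; linarith⟩
    set t := (c - a) / (b - a)
    have hmem : (1 - t) • z + t • y ∈ interior K :=
      hK.openSegment_interior_closure_subset_interior hz (subset_closure hy)
        ⟨1 - t, t, by linarith, hpos.1, by ring, rfl⟩
    refine h _ hmem ?_
    simp only [inner_add_right, inner_smul_right]
    change (1 - t) * a + t * b = c
    have : t * (b - a) = c - a := div_mul_cancel₀ _ hd
    linarith
  rcases lt_or_gt_of_ne (h z hz) with h1 | h1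
  · left; intro y hy; by_contra! h2; nlinarith [key y hy]
  · right; intro y hy; by_contra! h2; nlinarith [key y hy]

end CentralProjection

/-! ### Invariance of domain for maps into planes and convex boundaries. -/

section PlaneInvarianceOfDomain

variable {E : Type*} [NormedAddCommGroup E] [NormedSpace ℝ E]

theorem finrank_orthogonal_singleton_R3 {n : R3} (hn : n ≠ 0) :
    Module.finrank ℝ (ℝ ∙ n)ᗮ = 2 := by
  have : Fact (Module.finrank ℝ R3 = 2 + 1) := ⟨by simp⟩
  exact Submodule.finrank_orthogonal_span_singleton hn

theorem injOn_orthogonalProjectionOnto_plane (n : R3) (c : ℝ) :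
    InjOn ((ℝ ∙ n)ᗮ.orthogonalProjectionOnto) {x : R3 | inner ℝ n x = c} := by
  intro x hx y hy h
  have h1 : (ℝ ∙ n)ᗮ.orthogonalProjectionOnto (x - y) = 0 := by rw [map_sub, h, sub_self]
  rw [Submodule.orthogonalProjectionOnto_eq_zero_iff, Submodule.orthogonal_orthogonal] at h1
  obtain ⟨a, ha⟩ := Submodule.mem_span_singleton.mp h1
  have h2 : inner ℝ n (x - y) = 0 := by
    rw [inner_sub_right, show inner ℝ n x = c from hx, show inner ℝ n y = c from hy, sub_self]
  have h3 : inner ℝ (x - y) (x - y) = 0 := by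
    nth_rewrite 1 [← ha]
    rw [real_inner_smul_left, h2, mul_zero]
  exact sub_eq_zero.mp (inner_self_eq_zero.mp h3)

theorem eventually_mem_image_of_injOn_plane (hE : Module.finrank ℝ E = 2) {n : R3} (hn : n ≠ 0)
    {c : ℝ} {O : Set E} (hO : IsOpen O) {ψ : E → R3} (hc : ContinuousOn ψ O) (hi : InjOn ψ O)
    (hψ : ∀ v ∈ O, inner ℝ n (ψ v) = c) {v : E} (hv : v ∈ O) :
    ∀ᶠ y in 𝓝 (ψ v), inner ℝ n y = c → y ∈ ψ '' O := by
  let P := (ℝ ∙ n)ᗮ.orthogonalProjectionOnto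
  have hP := injOn_orthogonalProjectionOnto_plane n c
  have h1 := image_mem_nhds_of_injOn_of_finrank_eq_two hE (finrank_orthogonal_singleton_R3 hn) hO
    (P.continuous.comp_continuousOn hc) (fun a ha b hb hab => hi ha hb (hP (hψ a ha) (hψ b hb) hab))
    hv
  filter_upwards [P.continuous.continuousAt.preimage_mem_nhds h1] with y hy hyc
  obtain ⟨w, hw, hwy⟩ := hy
  exact ⟨w, hw, hP (hψ w hw) hyc hwy⟩

end PlaneInvarianceOfDomain

section PlanarPoints

variable {M : Type*} [TopologicalSpace M]

/-- A point with a neighborhood parametrized by an open subset of the plane. -/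
def IsPlanarPoint (q : M) : Prop :=
  ∃ (O : Set (EuclideanSpace ℝ (Fin 2))) (φ : EuclideanSpace ℝ (Fin 2) → M),
    IsOpen O ∧ ContinuousOn φ O ∧ InjOn φ O ∧ q ∈ interior (φ '' O)

theorem isOpen_setOf_isPlanarPoint : IsOpen {q : M | IsPlanarPoint q} := by
  rw [isOpen_iff_mem_nhds]
  rintro q ⟨O, φ, hO, hc, hi, hq⟩
  filter_upwards [isOpen_interior.mem_nhds hq] with x hx
  exact ⟨O, φ, hO, hc, hi, hx⟩

theorem isPlanarPoint_of_mem_interior [ChartedSpace (EuclideanHalfSpace 2) M] {q : M}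
    (hq : q ∈ (𝓡∂ 2).interior M) : IsPlanarPoint q := by
  have hq' : extChartAt (𝓡∂ 2) q q ∈ interior (range (𝓡∂ 2)) := hq
  refine ⟨interior (extChartAt (𝓡∂ 2) q).target, (extChartAt (𝓡∂ 2) q).symm, isOpen_interior,
    (continuousOn_extChartAt_symm q).mono interior_subset,
    (extChartAt (𝓡∂ 2) q).symm.injOn.mono interior_subset, ?_⟩
  have h1 : (extChartAt (𝓡∂ 2) q).target ∈ 𝓝 (extChartAt (𝓡∂ 2) q q) := by
    have := extChartAt_target_mem_nhdsWithin (I := 𝓡∂ 2) q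
    rwa [nhdsWithin_eq_nhds.mpr (mem_interior_iff_mem_nhds.mp hq')] at this
  rw [mem_interior_iff_mem_nhds]
  filter_upwards [(continuousAt_extChartAt (I := 𝓡∂ 2) q).preimage_mem_nhds
    (interior_mem_nhds.mpr h1), extChartAt_source_mem_nhds (I := 𝓡∂ 2) q] with x hx hxs
  exact ⟨_, hx, (extChartAt (𝓡∂ 2) q).left_inv hxs⟩

/-- Lets the boundary hypotheses be applied at nonplanar points. The converse, that boundary points
are never planar, is not needed. -/
theorem mem_boundary_of_not_isPlanarPoint [ChartedSpace (EuclideanHalfSpace 2) M] {q : M}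
    (hq : ¬ IsPlanarPoint q) : q ∈ (𝓡∂ 2).boundary M := by
  rw [← ModelWithCorners.compl_interior]
  exact fun h => hq (isPlanarPoint_of_mem_interior h)

theorem IsPlanarPoint.exists_parametrization {q : M} (hq : IsPlanarPoint q) {U : Set M}
    (hU : U ∈ 𝓝 q) : ∃ (O : Set (EuclideanSpace ℝ (Fin 2))) (φ : EuclideanSpace ℝ (Fin 2) → M),
      IsOpen O ∧ ContinuousOn φ O ∧ InjOn φ O ∧ (∀ v ∈ O, φ v ∈ U) ∧ ∃ v ∈ O, φ v = q := by
  obtain ⟨O, φ, hO, hc, hi, hq⟩ := hq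
  obtain ⟨v, hv, rfl⟩ := interior_subset hq
  exact ⟨O ∩ φ ⁻¹' interior U, φ, hc.isOpen_inter_preimage hO isOpen_interior,
    hc.mono inter_subset_left, hi.mono inter_subset_left, fun w hw => interior_subset hw.2,
    v, ⟨hv, mem_interior_iff_mem_nhds.mpr hU⟩, rfl⟩

/-- Near a planar point, a locally injective map into a plane is onto a neighborhood in it. -/
theorem IsPlanarPoint.eventually_mem_image_plane {q : M} (hq : IsPlanarPoint q) {f : M → R3}
    (hf : Continuous f) {U : Set M} (hU : U ∈ 𝓝 q) (hinj : InjOn f U) {n : R3} (hn : n ≠ 0) {c : ℝ}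
    (hUH : ∀ x ∈ U, inner ℝ n (f x) = c) :
    ∀ᶠ y in 𝓝 (f q), inner ℝ n y = c → y ∈ f '' U := by
  obtain ⟨O, φ, hO, hc, hi, hOU, v, hv, rfl⟩ := hq.exists_parametrization hU
  filter_upwards [eventually_mem_image_of_injOn_plane (by simp) hn hO (hf.comp_continuousOn hc)
    (fun a ha b hb hab => hi ha hb (hinj (hOU a ha) (hOU b hb) hab))
    (fun w hw => hUH _ (hOU w hw)) hv] with y hy hyc
  obtain ⟨w, hw, rfl⟩ := hy hyc
  exact ⟨φ w, hOU w hw, rfl⟩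

/-- Near a planar point, a locally injective map into the boundary of a convex set is onto a
neighborhood in it. -/
theorem IsPlanarPoint.eventually_mem_image_frontier {q : M} (hq : IsPlanarPoint q) {f : M → R3}
    (hf : Continuous f) {U : Set M} (hU : U ∈ 𝓝 q) (hinj : InjOn f U) {K : Set R3}
    (hK : Convex ℝ K) (hKi : (interior K).Nonempty) (hUK : ∀ x ∈ U, f x ∈ frontier K) :
    ∀ᶠ y in 𝓝 (f q), y ∈ frontier K → y ∈ f '' U := by
  obtain ⟨z, hzK⟩ := hKi
  have hqK : f q ∈ frontier K := hUK q (mem_of_mem_nhds hU)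
  have hn : f q - z ≠ 0 := by
    rw [sub_ne_zero]; rintro h; rw [h] at hqK; exact hqK.2 hzK
  -- The auxiliary plane passes through `f q` orthogonally to `f q - z`, so it misses `z` and
  -- central projection from `z` fixes `f q`.
  obtain ⟨c, hc⟩ : ∃ c, c = inner ℝ (f q - z) (f q) := ⟨_, rfl⟩
  have hz : inner ℝ (f q - z) z ≠ c := by
    rw [hc]
    intro h
    have : inner ℝ (f q - z) (f q - z) = 0 := by rw [inner_sub_right, h, sub_self]
    exact hn (inner_self_eq_zero.mp this)
  set n := f q - z
  have hW := isOpen_visibleHalfSpace.mem_nhds (mem_visibleHalfSpace hz hc.symm)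
  obtain ⟨O, φ, hO, hφc, hi, hOU, v, hv, rfl⟩ := hq.exists_parametrization
    (Filter.inter_mem hU (hf.continuousAt.preimage_mem_nhds hW))
  have hmem : ∀ w ∈ O, f (φ w) ∈ frontier K ∩ visibleHalfSpace n c z := fun w hw =>
    ⟨hUK _ (hOU w hw).1, (hOU w hw).2⟩
  have hev := eventually_mem_image_of_injOn_plane (ψ := fun w => centralProjection n c z (f (φ w)))
    (by simp) hn hO (continuousOn_centralProjection.comp (hf.comp_continuousOn hφc)
      (fun w hw => (hmem w hw).2))
    (fun a ha b hb hab => hi ha hb (hinj (hOU a ha).1 (hOU b hb).1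
      (injOn_centralProjection hK hzK (hmem a ha) (hmem b hb) hab)))
    (fun w hw => inner_centralProjection (hmem w hw).2) hv
  rw [centralProjection_eq_self hz hc.symm] at hev
  filter_upwards [hW, (tendsto_centralProjection hz hc.symm).eventually hev] with y hyW hy hyK
  obtain ⟨w, hw, hwy⟩ := hy (inner_centralProjection hyW)
  exact ⟨φ w, (hOU w hw).1, injOn_centralProjection hK hzK (hmem w hw) ⟨hyK, hyW⟩ hwy⟩

end PlanarPoints

/-! ### Curves without inflections. -/

section Curves

theorem deriv_eq_zero_of_frequently_eq {h : ℝ → ℝ} {t₀ : ℝ} (hd : DifferentiableAt ℝ h t₀)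
    (hfr : ∃ᶠ t in 𝓝[≠] t₀, h t = h t₀) : deriv h t₀ = 0 := by
  have h1 := hasDerivAt_iff_tendsto_slope.mp hd.hasDerivAt
  by_contra hne
  refine hfr ((h1.eventually_ne hne).mono fun t ht heq => ht ?_)
  rw [slope_def_field, heq, sub_self, zero_div]

/-- Rolle's theorem between `t₀` and each nearby return. It lets the first-derivative argument be
repeated for the second derivative. -/
theorem frequently_deriv_eq_zero_of_frequently_eq {h : ℝ → ℝ} {t₀ : ℝ}
    (hd : ∀ᶠ t in 𝓝 t₀, DifferentiableAt ℝ h t) (hfr : ∃ᶠ t in 𝓝[≠] t₀, h t = h t₀) :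
    ∃ᶠ t in 𝓝[≠] t₀, deriv h t = 0 := by
  intro hev
  obtain ⟨ε, hε, hball⟩ := Metric.eventually_nhds_iff_ball.mp
    (hd.and (eventually_nhdsWithin_iff.mp hev))
  obtain ⟨t, ht, htε, htne⟩ := (hfr.and_eventually (Filter.Eventually.and
    (nhdsWithin_le_nhds (Metric.ball_mem_nhds t₀ hε)) self_mem_nhdsWithin)).exists
  replace htε : t ∈ Metric.ball t₀ ε := htε
  rw [Real.ball_eq_Ioo] at hball htε
  rcases lt_or_gt_of_ne htne with hlt | hlt
  · obtain ⟨s, hs, hs0⟩ := exists_deriv_eq_zero hlt (fun s hs =>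
      (hball s ⟨htε.1.trans_le hs.1, by linarith [hs.2]⟩).1.continuousAt.continuousWithinAt) ht
    exact (hball s ⟨htε.1.trans hs.1, by linarith [hs.2]⟩).2 hs.2.ne hs0
  · obtain ⟨s, hs, hs0⟩ := exists_deriv_eq_zero hlt (fun s hs =>
      (hball s ⟨by linarith [hs.1], hs.2.trans_lt htε.2⟩).1.continuousAt.continuousWithinAt) ht.symm
    exact (hball s ⟨by linarith [hs.1], hs.2.trans htε.2⟩).2 hs.1.ne' hs0

/-- If a `C²` curve returns to a hyperplane arbitrarily close to `t₀`, then its velocity and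
acceleration at `t₀` are parallel to the hyperplane. -/
theorem inner_deriv_eq_zero_of_frequently {E : Type*} [NormedAddCommGroup E]
    [InnerProductSpace ℝ E] {γ : ℝ → E} {T : Set ℝ} (hT : IsOpen T) (hγ : ContDiffOn ℝ 2 γ T)
    {t₀ : ℝ} (ht₀ : t₀ ∈ T) (w : E) (hfr : ∃ᶠ t in 𝓝[≠] t₀, inner ℝ w (γ t) = inner ℝ w (γ t₀)) :
    inner ℝ w (deriv γ t₀) = 0 ∧ inner ℝ w (deriv (deriv γ) t₀) = 0 := by
  have hd : ∀ t ∈ T, DifferentiableAt ℝ γ t := fun t ht =>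
    (hγ.contDiffAt (hT.mem_nhds ht)).differentiableAt (by norm_num)
  have hd2 : DifferentiableAt ℝ (deriv γ) t₀ := by
    have h1 : ContDiffOn ℝ 1 (deriv γ) T := hγ.deriv_of_isOpen hT (by norm_num)
    exact (h1.contDiffAt (hT.mem_nhds ht₀)).differentiableAt (by norm_num)
  let h : ℝ → ℝ := fun t => inner ℝ w (γ t)
  have hh : ∀ t ∈ T, HasDerivAt h (inner ℝ w (deriv γ t)) t := fun t ht => by
    simpa using (hasDerivAt_const t w).inner ℝ (hd t ht).hasDerivAt
  have hder : deriv h =ᶠ[𝓝 t₀] fun t => inner ℝ w (deriv γ t) := by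
    filter_upwards [hT.mem_nhds ht₀] with t ht
    exact (hh t ht).deriv
  have h1 : deriv h t₀ = 0 := deriv_eq_zero_of_frequently_eq (hh t₀ ht₀).differentiableAt hfr
  have h2 : HasDerivAt (deriv h) (inner ℝ w (deriv (deriv γ) t₀)) t₀ := by
    refine HasDerivAt.congr_of_eventuallyEq ?_ hder
    simpa using (hasDerivAt_const t₀ w).inner ℝ hd2.hasDerivAt
  refine ⟨by rw [← (hh t₀ ht₀).deriv, h1], ?_⟩
  rw [← h2.deriv]
  refine deriv_eq_zero_of_frequently_eq h2.differentiableAt ?_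
  rw [h1]
  exact frequently_deriv_eq_zero_of_frequently_eq
    (Filter.eventually_of_mem (hT.mem_nhds ht₀) fun t ht => (hh t ht).differentiableAt) hfr

theorem finrank_orthogonal_pair {n e : R3} (hn : n ≠ 0) (he : e ≠ 0) (hne : inner ℝ n e = 0) :
    Module.finrank ℝ (Submodule.span ℝ {n, e})ᗮ = 1 := by
  have hli : LinearIndependent ℝ ![n, e] := by
    rw [LinearIndependent.pair_iff]
    intro s t hst
    have h1 : inner ℝ n (s • n + t • e) = 0 := by rw [hst, inner_zero_right]
    have h2 : inner ℝ e (s • n + t • e) = 0 := by rw [hst, inner_zero_right]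
    rw [inner_add_right, inner_smul_right, inner_smul_right, hne] at h1
    rw [inner_add_right, inner_smul_right, inner_smul_right, real_inner_comm, hne] at h2
    constructor
    · simpa [hn] using h1
    · simpa [he] using h2
  have h1 : Module.finrank ℝ (Submodule.span ℝ {n, e}) = 2 := by
    have := finrank_span_eq_card hli
    rwa [Matrix.range_cons, Matrix.range_cons, Matrix.range_empty, union_empty,
      singleton_union, Fintype.card_fin] at this
  have h2 := Submodule.finrank_add_finrank_orthogonal (Submodule.span ℝ {n, e})
  rw [h1] at h2
  simp at h2
  omega

theorem mem_orthogonal_pair {n e x : R3} (hn : inner ℝ n x = 0) (he : inner ℝ e x = 0) :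
    x ∈ (Submodule.span ℝ {n, e})ᗮ := by
  rw [Submodule.mem_orthogonal]
  intro u hu
  obtain ⟨a, b, rfl⟩ := Submodule.mem_span_pair.mp hu
  rw [inner_add_left, real_inner_smul_left, real_inner_smul_left, hn, he]
  simp

/-- A curve without inflections meets a line in isolated points. -/
theorem eventually_notMem_of_linearIndependent {γ : ℝ → R3} {T : Set ℝ} (hT : IsOpen T)
    (hγ : ContDiffOn ℝ 2 γ T) {t₀ : ℝ} (ht₀ : t₀ ∈ T)
    (hli : LinearIndependent ℝ ![deriv γ t₀, deriv (deriv γ) t₀]) {n e : R3} (hn : n ≠ 0)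
    (he : e ≠ 0) (hne : inner ℝ n e = 0) :
    ∀ᶠ t in 𝓝[≠] t₀, ¬ (inner ℝ n (γ t) = inner ℝ n (γ t₀) ∧ inner ℝ e (γ t) = inner ℝ e (γ t₀)) := by
  by_contra hfr
  have h1 := inner_deriv_eq_zero_of_frequently hT hγ ht₀ n
    (Filter.Frequently.mono hfr fun t ht => ht.1)
  have h2 := inner_deriv_eq_zero_of_frequently hT hγ ht₀ e
    (Filter.Frequently.mono hfr fun t ht => ht.2)
  have h3 := finrank_span_eq_card hli
  have hle : Submodule.span ℝ (range ![deriv γ t₀, deriv (deriv γ) t₀])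
      ≤ (Submodule.span ℝ {n, e})ᗮ := by
    rw [Submodule.span_le]
    rintro _ ⟨i, rfl⟩
    fin_cases i
    · exact mem_orthogonal_pair h1.1 h2.1
    · exact mem_orthogonal_pair h1.2 h2.2
  have h4 := Submodule.finrank_mono hle
  rw [h3, finrank_orthogonal_pair hn he hne] at h4
  simp at h4

theorem isolated_boundary_point_of_linear {M : Type*} [TopologicalSpace M]
    [ChartedSpace (EuclideanHalfSpace 2) M] {f : M → R3}
    (hf : IsC2WithoutInflectionsOnBoundary f) {n e : R3} (hn : n ≠ 0) (he : e ≠ 0)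
    (hne : inner ℝ n e = 0) {q : M} (hq : q ∈ (𝓡∂ 2).boundary M) :
    ∀ᶠ x in 𝓝 q, x ∈ (𝓡∂ 2).boundary M → inner ℝ n (f x) = inner ℝ n (f q) →
      inner ℝ e (f x) = inner ℝ e (f q) → x = q := by
  obtain ⟨κ, hqκ, hγ, hli⟩ := hf ⟨q, hq⟩
  have ht₀ := κ.map_source hqκ
  have hev := eventually_notMem_of_linearIndependent κ.open_target hγ ht₀ (hli _ ht₀) hn he hne
  rw [eventually_nhdsWithin_iff] at hev
  have hev2 := ((κ.continuousAt hqκ).eventually hev).and (κ.open_source.mem_nhds hqκ)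
  rw [nhds_subtype_eq_comap, Filter.eventually_comap] at hev2
  filter_upwards [hev2] with x hx hxb h1 h2
  obtain ⟨h3, h4⟩ := hx ⟨x, hxb⟩ rfl
  rw [κ.left_inv hqκ, κ.left_inv h4] at h3
  by_contra hxq
  refine h3 (fun h => hxq ?_) ⟨h1, h2⟩
  exact congrArg Subtype.val (κ.injOn h4 hqκ h)

end Curves

/-! ### Thin convex sets and collinear star-shaped sets. -/

section ConvexSets

theorem exists_ne_zero_inner_sub_eq_zero {E : Type*} [NormedAddCommGroup E] [InnerProductSpace ℝ E]
    [FiniteDimensional ℝ E] {D : Set E} (hD : Convex ℝ D) (hne : D.Nonempty)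
    (hint : ¬ (interior D).Nonempty) : ∃ e : E, e ≠ 0 ∧ ∀ x ∈ D, ∀ y ∈ D, inner ℝ e (x - y) = 0 := by
  rw [hD.interior_nonempty_iff_affineSpan_eq_top,
    AffineSubspace.affineSpan_eq_top_iff_vectorSpan_eq_top_of_nonempty ℝ E E hne,
    ← Submodule.orthogonal_eq_bot_iff, Submodule.eq_bot_iff] at hint
  push Not at hint
  obtain ⟨e, he, he0⟩ := hint
  exact ⟨e, he0, fun x hx y hy => Submodule.inner_left_of_mem_orthogonal
    (vsub_mem_vectorSpan ℝ hx hy) he⟩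

theorem collinear_of_inner_sub_eq_zero {n e : R3} (hn : n ≠ 0) (he : e ≠ 0) (hne : inner ℝ n e = 0)
    {D : Set R3} (h1 : ∀ x ∈ D, ∀ y ∈ D, inner ℝ n (x - y) = 0)
    (h2 : ∀ x ∈ D, ∀ y ∈ D, inner ℝ e (x - y) = 0) : Collinear ℝ D := by
  rw [collinear_iff_finrank_le_one, ← finrank_orthogonal_pair hn he hne]
  refine Submodule.finrank_mono ?_
  rw [vectorSpan, Submodule.span_le]
  rintro _ ⟨x, hx, y, hy, rfl⟩
  exact mem_orthogonal_pair (h1 x hx y hy) (h2 x hx y hy)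

theorem StarConvex.convex_of_collinear {E : Type*} [AddCommGroup E] [Module ℝ E] {X : Set E} {a : E}
    (hX : StarConvex ℝ a X) (ha : a ∈ X) (hc : Collinear ℝ X) : Convex ℝ X := by
  rw [convex_iff_segment_subset]
  intro x hx y hy
  have hseg : ∀ z ∈ X, segment ℝ a z ⊆ X := fun z hz => hX.segment_subset hz
  have h3 : Collinear ℝ {a, x, y} := hc.subset (by
    rintro z (rfl | rfl | rfl) <;> assumption)
  rcases h3.wbtw_or_wbtw_or_wbtw with h | h | h <;> rw [← mem_segment_iff_wbtw] at h
  · exact ((convex_segment a y).segment_subset h (right_mem_segment ℝ a y)).trans (hseg y hy)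
  · refine ((convex_segment x a).segment_subset (left_mem_segment ℝ x a) h).trans ?_
    rw [segment_symm]
    exact hseg x hx
  · rw [segment_symm]
    refine (segment_subset_union_of_mem h).trans (union_subset ?_ (hseg x hx))
    rw [segment_symm]
    exact hseg y hy

end ConvexSets

/-! ### Local structure of f⁻¹(H) near limits of support points. -/

section LocalStructure

variable {M : Type*} [TopologicalSpace M]

/-- The planar points of `f ⁻¹' H`, for the plane `H` given by `⟪n, x⟫ = c`, near which `f` lies on
one side of `H`. -/
def supportPoints (f : M → R3) (n : R3) (c : ℝ) : Set M :=
  {q | IsPlanarPoint q ∧ inner ℝ n (f q) = c ∧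
    ((∀ᶠ x in 𝓝 q, inner ℝ n (f x) ≤ c) ∨ ∀ᶠ x in 𝓝 q, c ≤ inner ℝ n (f x))}

variable {f : M → R3} {n : R3} {c : ℝ}

/-- Near `f q` every point of the frontier of `K` is a value of `f` near `q`, so the one-sidedness
of `f` is one-sidedness of the frontier, and `inner_ne_of_locally_supporting` applies. -/
theorem inner_ne_of_mem_supportPoints (hf : Continuous f) (hn : n ≠ 0) {q : M}
    (hq : q ∈ supportPoints f n c) {U : Set M} (hU : U ∈ 𝓝 q) (hinj : InjOn f U) {K : Set R3}
    (hK : IsConvexBody K) (hUK : ∀ x ∈ U, f x ∈ frontier K) :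
    ∀ z ∈ interior K, inner ℝ n z ≠ c := by
  obtain ⟨hqp, hqc, hside⟩ := hq
  have hqK := hUK q (mem_of_mem_nhds hU)
  have key : ∀ V ∈ 𝓝 q, ∀ᶠ y in 𝓝 (f q), y ∈ frontier K → y ∈ f '' (U ∩ V) := fun V hV =>
    hqp.eventually_mem_image_frontier hf (Filter.inter_mem hU hV) (hinj.mono inter_subset_left)
      hK.2.1 hK.2.2 fun x hx => hUK x hx.1
  rcases hside with h | h
  · refine inner_ne_of_locally_supporting hK.2.1 hK.1.isClosed hn hqK hqc ?_
    filter_upwards [key _ h] with y hy hyK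
    obtain ⟨x, ⟨-, hx⟩, rfl⟩ := hy hyK
    exact hx
  · intro z hz hzc
    refine inner_ne_of_locally_supporting (n := -n) (c := -c) hK.2.1 hK.1.isClosed
      (neg_ne_zero.mpr hn) hqK (by rw [inner_neg_left, hqc]) ?_ z hz (by rw [inner_neg_left, hzc])
    filter_upwards [key _ h] with y hy hyK
    obtain ⟨x, ⟨-, hx⟩, rfl⟩ := hy hyK
    rw [inner_neg_left]
    exact neg_le_neg hx

/-- A compact neighborhood `U` which `f` embeds into the boundary of a convex body `K` supported by
the plane `⟪n, x⟫ = c`. -/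
structure IsSupportedPatch (f : M → R3) (n : R3) (c : ℝ) (U : Set M) (K : Set R3) : Prop where
  isCompact : IsCompact U
  injOn : InjOn f U
  isConvexBody : IsConvexBody K
  mem_frontier : ∀ x ∈ U, f x ∈ frontier K
  inner_ne : ∀ z ∈ interior K, inner ℝ n z ≠ c

/-- A patch around a limit `q` contains a genuine support point in its interior. That `H` misses the
interior of `K` is learned there and holds for the patch of `q`, though `f` need not be known to be
onto the frontier near `f q`. -/
theorem exists_isSupportedPatch [T2Space M] [CompactSpace M] (hf : IsLocallyConvexImmersion f)
    (hn : n ≠ 0) {q : M} (hq : q ∈ closure (supportPoints f n c)) {W : Set M} (hW : W ∈ 𝓝 q) :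
    ∃ U ∈ 𝓝 q, U ⊆ W ∧ ∃ K, IsSupportedPatch f n c U K := by
  obtain ⟨U₀, hU₀, hinj⟩ := hf.2.1 q
  obtain ⟨U₁, hU₁, K, hK, hUK⟩ := hf.2.2 q
  obtain ⟨U, hU, hUsub, hUc⟩ := local_compact_nhds (Filter.inter_mem hW (Filter.inter_mem hU₀ hU₁))
  have hinjU : InjOn f U := hinj.mono fun x hx => (hUsub hx).2.1
  have hUKU : ∀ x ∈ U, f x ∈ frontier K := fun x hx => hUK (mem_image_of_mem f (hUsub hx).2.2)
  refine ⟨U, hU, fun x hx => (hUsub hx).1, K, hUc, hinjU, hK, hUKU, ?_⟩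
  obtain ⟨s, hsU, hs⟩ := mem_closure_iff_nhds.mp hq _ (interior_mem_nhds.mpr hU)
  exact inner_ne_of_mem_supportPoints hf.1 hn hs (mem_interior_iff_mem_nhds.mp hsU) hinjU hK hUKU

variable {U : Set M} {K : Set R3}

namespace IsSupportedPatch

theorem convex (h : IsSupportedPatch f n c U K) : Convex ℝ K := h.isConvexBody.2.1

theorem mem_of_mem (h : IsSupportedPatch f n c U K) {x : M} (hx : x ∈ U) : f x ∈ K :=
  h.isConvexBody.1.isClosed.frontier_subset (h.mem_frontier x hx)

theorem mem_frontier_of_inner_eq (h : IsSupportedPatch f n c U K) {y : R3} (hy : y ∈ K)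
    (hyc : inner ℝ n y = c) : y ∈ frontier K :=
  ⟨subset_closure hy, fun hi => h.inner_ne y hi hyc⟩

theorem mono (h : IsSupportedPatch f n c U K) {V : Set M} (hVU : V ⊆ U) (hV : IsCompact V) :
    IsSupportedPatch f n c V K :=
  ⟨hV, h.injOn.mono hVU, h.isConvexBody, fun x hx => h.mem_frontier x (hVU hx), h.inner_ne⟩

theorem one_sided (h : IsSupportedPatch f n c U K) :
    (∀ x ∈ U, inner ℝ n (f x) ≤ c) ∨ ∀ x ∈ U, c ≤ inner ℝ n (f x) :=
  (inner_le_or_le_of_inner_ne h.convex h.isConvexBody.2.2 h.inner_ne).imp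
    (fun hK _ hx => hK _ (h.mem_of_mem hx)) (fun hK _ hx => hK _ (h.mem_of_mem hx))

theorem mem_supportPoints (h : IsSupportedPatch f n c U K) {x : M} (hx : x ∈ interior U)
    (hxp : IsPlanarPoint x) (hxc : inner ℝ n (f x) = c) : x ∈ supportPoints f n c :=
  ⟨hxp, hxc, h.one_sided.imp
    (fun hU => Filter.eventually_of_mem (mem_interior_iff_mem_nhds.mp hx) hU)
    (fun hU => Filter.eventually_of_mem (mem_interior_iff_mem_nhds.mp hx) hU)⟩

theorem eventually_mem_image (h : IsSupportedPatch f n c U K) (hf : Continuous f) {x : M}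
    (hx : x ∈ interior U) (hxp : IsPlanarPoint x) :
    ∀ᶠ y in 𝓝 (f x), y ∈ frontier K → y ∈ f '' U :=
  hxp.eventually_mem_image_frontier hf (mem_interior_iff_mem_nhds.mp hx) h.injOn h.convex
    h.isConvexBody.2.2 h.mem_frontier

/-- An injective continuous map on a compact set is an embedding, so small balls in space cut out
small parts of `U`. -/
theorem exists_radius (h : IsSupportedPatch f n c U K) (hf : Continuous f) {q : M} (hqU : q ∈ U)
    {N : Set M} (hN : N ∈ 𝓝 q) : ∃ r > 0, ∀ x ∈ U, f x ∈ Metric.closedBall (f q) r → x ∈ N := by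
  have hc : IsCompact (f '' (U \ interior N)) := (h.isCompact.diff isOpen_interior).image hf
  have hq : f q ∉ f '' (U \ interior N) := by
    rintro ⟨x, ⟨hxU, hxN⟩, hx⟩
    rw [h.injOn hxU hqU hx] at hxN
    exact hxN (mem_interior_iff_mem_nhds.mpr hN)
  obtain ⟨r, hr, hsub⟩ := Metric.nhds_basis_closedBall.mem_iff.mp
    (hc.isClosed.isOpen_compl.mem_nhds hq)
  refine ⟨r, hr, fun x hxU hx => ?_⟩
  by_contra hxN
  exact hsub hx ⟨x, ⟨hxU, fun h => hxN (interior_subset h)⟩, rfl⟩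

/-- A connected part of the boundary of `K` which meets `f '' U` only at images of planar points is
contained in `f '' U` as soon as it meets it. -/
theorem subset_image_of_isPreconnected (h : IsSupportedPatch f n c U K) (hf : Continuous f)
    {C : Set R3} (hC : IsPreconnected C) (hCK : C ⊆ frontier K)
    (hCp : ∀ x ∈ U, f x ∈ C → x ∈ interior U ∧ IsPlanarPoint x) (hne : (C ∩ f '' U).Nonempty) :
    C ⊆ f '' U := by
  let G : Set R3 := {y | ∀ᶠ y' in 𝓝 y, y' ∈ frontier K → y' ∈ f '' U}
  have hG : IsOpen G := by
    rw [isOpen_iff_mem_nhds]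
    exact fun y hy => eventually_eventually_nhds.mpr hy
  -- On `C` the closed set `f '' U` coincides with the open set `G`, so it is relatively open and
  -- closed there.
  have hCG : ∀ y ∈ C, y ∈ f '' U → y ∈ G := by
    rintro _ hy ⟨x, hx, rfl⟩
    obtain ⟨h1, h2⟩ := hCp x hx hy
    exact h.eventually_mem_image hf h1 h2
  by_contra hsub
  obtain ⟨y, hyC, hyU⟩ := not_subset.mp hsub
  obtain ⟨y₀, hy₀C, hy₀U⟩ := hne
  obtain ⟨w, hwC, hwG, hwU⟩ := hC G (f '' U)ᶜ hG (h.isCompact.image hf).isClosed.isOpen_compl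
    (fun w hw => (em (w ∈ f '' U)).imp_left (hCG w hw)) ⟨y₀, hy₀C, hCG y₀ hy₀C hy₀U⟩ ⟨y, hyC, hyU⟩
  exact hwU (mem_of_mem_nhds hwG (hCK hwC))

theorem image_inter_eq {M : Type*} (f : M → R3) (n : R3) (c : ℝ) (U : Set M) (B : Set R3) :
    f '' ((U ∩ f ⁻¹' B) ∩ {x | inner ℝ n (f x) = c}) =
      f '' U ∩ ({y | inner ℝ n y = c} ∩ B) := by
  ext y
  constructor
  · rintro ⟨x, ⟨⟨hx, hxB⟩, hxc⟩, rfl⟩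
    exact ⟨⟨x, hx, rfl⟩, hxc, hxB⟩
  · rintro ⟨⟨x, hx, rfl⟩, hxc, hxB⟩
    exact ⟨x, ⟨⟨hx, hxB⟩, hxc⟩, rfl⟩

end IsSupportedPatch

/-- The conclusion of the local analysis at a point `q`: a neighborhood of `q` in `f ⁻¹' H` is
embedded onto a convex set and consists of limits of support points. -/
def HasConvexPatch (f : M → R3) (n : R3) (c : ℝ) (q : M) : Prop :=
  ∃ U ∈ 𝓝 q, (∃ K, IsSupportedPatch f n c U K) ∧
    Convex ℝ (f '' (U ∩ {x | inner ℝ n (f x) = c})) ∧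
    U ∩ {x | inner ℝ n (f x) = c} ⊆ closure (supportPoints f n c)

theorem isClosed_setOf_inner_eq (hf : Continuous f) : IsClosed {x | inner ℝ n (f x) = c} :=
  isClosed_eq (by fun_prop) continuous_const

theorem convex_plane (n : R3) (c : ℝ) : Convex ℝ {y : R3 | inner ℝ n y = c} := by
  intro x hx y hy a b _ _ hab
  simp only [mem_ofPred_eq] at hx hy ⊢
  rw [inner_add_right, inner_smul_right, inner_smul_right, hx, hy, ← add_mul, hab, one_mul]

/-- Here `f '' U` fills the frontier of `K` near `f q`, so the image of the patch is the
intersection of `K`, `H` and a ball. One radius keeps preimages inside `interior U`, the other keeps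
the frontier inside `f '' U`. -/
theorem hasConvexPatch_of_isPlanarPoint [T2Space M] [CompactSpace M]
    (hf : IsLocallyConvexImmersion f) (hn : n ≠ 0) {q : M}
    (hq : q ∈ closure (supportPoints f n c)) (hqp : IsPlanarPoint q) : HasConvexPatch f n c q := by
  obtain ⟨U, hU, hUW, K, h⟩ :=
    exists_isSupportedPatch hf hn hq (isOpen_setOf_isPlanarPoint.mem_nhds hqp)
  obtain ⟨r₁, hr₁, hint⟩ := h.exists_radius hf.1 (mem_of_mem_nhds hU) (interior_mem_nhds.mpr hU)
  obtain ⟨r₂, hr₂, hball⟩ := Metric.nhds_basis_closedBall.mem_iff.mp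
    (h.eventually_mem_image hf.1 (mem_interior_iff_mem_nhds.mpr hU) hqp)
  set B := Metric.closedBall (f q) (min r₁ r₂)
  have hB1 : B ⊆ Metric.closedBall (f q) r₁ := Metric.closedBall_subset_closedBall (min_le_left _ _)
  have hB2 : B ⊆ Metric.closedBall (f q) r₂ := Metric.closedBall_subset_closedBall (min_le_right _ _)
  have hBn : B ∈ 𝓝 (f q) := Metric.closedBall_mem_nhds _ (lt_min hr₁ hr₂)
  refine ⟨U ∩ f ⁻¹' B, Filter.inter_mem hU (hf.1.continuousAt.preimage_mem_nhds hBn),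
    ⟨K, h.mono inter_subset_left (h.isCompact.inter_right (Metric.isClosed_closedBall.preimage hf.1))⟩,
    ?_, ?_⟩
  · rw [IsSupportedPatch.image_inter_eq]
    have : f '' U ∩ ({y | inner ℝ n y = c} ∩ B) = K ∩ ({y | inner ℝ n y = c} ∩ B) := by
      ext y
      constructor
      · rintro ⟨⟨x, hx, rfl⟩, hy⟩
        exact ⟨h.mem_of_mem hx, hy⟩
      · rintro ⟨hyK, hyc, hyB⟩
        exact ⟨hball (hB2 hyB) (h.mem_frontier_of_inner_eq hyK hyc), hyc, hyB⟩
    rw [this]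
    exact h.convex.inter ((convex_plane n c).inter (convex_closedBall _ _))
  · rintro x ⟨⟨hxU, hxB⟩, hxc⟩
    exact subset_closure (h.mem_supportPoints (hint x hxU (hB1 hxB)) (hUW hxU) hxc)

/-- The local analysis at a boundary point for which the face `K ∩ H` of the convex body is contained
in a line. -/
theorem hasConvexPatch_of_linear [T2Space M] [CompactSpace M]
    [ChartedSpace (EuclideanHalfSpace 2) M] (hf : IsLocallyConvexImmersion f)
    (hbd : IsC2WithoutInflectionsOnBoundary f) (hn : n ≠ 0) {q : M}
    (hq : q ∈ closure (supportPoints f n c)) (hqc : inner ℝ n (f q) = c)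
    (hqb : q ∈ (𝓡∂ 2).boundary M) (hU : U ∈ 𝓝 q)
    (h : IsSupportedPatch f n c U K) {e : R3} (he : e ≠ 0) (hne : inner ℝ n e = 0)
    (hlin : ∀ x ∈ K ∩ {y | inner ℝ n y = c}, ∀ y ∈ K ∩ {y | inner ℝ n y = c},
      inner ℝ e (x - y) = 0) : HasConvexPatch f n c q := by
  have hiso := isolated_boundary_point_of_linear hbd hn he hne hqb
  obtain ⟨r, hr, hN⟩ := h.exists_radius hf.1 (mem_of_mem_nhds hU)
    (Filter.inter_mem (interior_mem_nhds.mpr hU) hiso)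
  have hqU := mem_of_mem_nhds hU
  set D := K ∩ {y | inner ℝ n y = c}
  have hDconv : Convex ℝ D := h.convex.inter (convex_plane n c)
  set B := Metric.closedBall (f q) r
  have hqD : f q ∈ D := ⟨h.mem_of_mem hqU, hqc⟩
  have hqB : f q ∈ B := Metric.mem_closedBall_self hr.le
  -- A nonplanar point would be a boundary point mapped to the line of the face, and `q` is the only
  -- such point nearby.
  have hpl : ∀ x ∈ U, f x ∈ D ∩ B → x ≠ q → x ∈ interior U ∧ IsPlanarPoint x := by
    rintro x hxU ⟨hxD, hxB⟩ hxq
    obtain ⟨h1, h2⟩ := hN x hxU hxB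
    refine ⟨h1, ?_⟩
    by_contra hxp
    refine hxq (h2 (mem_boundary_of_not_isPlanarPoint hxp) (by rw [hxD.2, hqc]) ?_)
    have := hlin _ hxD _ hqD
    rwa [inner_sub_right, sub_eq_zero] at this
  have heq : f '' U ∩ ({y | inner ℝ n y = c} ∩ B) = f '' U ∩ (D ∩ B) := by
    ext y
    constructor
    · rintro ⟨⟨x, hx, rfl⟩, hy⟩
      exact ⟨⟨x, hx, rfl⟩, ⟨h.mem_of_mem hx, hy.1⟩, hy.2⟩
    · rintro ⟨hy, hyD, hyB⟩
      exact ⟨hy, hyD.2, hyB⟩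
  refine ⟨U ∩ f ⁻¹' B, Filter.inter_mem hU (hf.1.continuousAt.preimage_mem_nhds
    (Metric.closedBall_mem_nhds _ hr)),
    ⟨K, h.mono inter_subset_left (h.isCompact.inter_right (Metric.isClosed_closedBall.preimage hf.1))⟩,
    ?_, ?_⟩
  · rw [IsSupportedPatch.image_inter_eq, heq]
    have hcol : Collinear ℝ D := by
      refine collinear_of_inner_sub_eq_zero hn he hne (fun x hx y hy => ?_) hlin
      rw [inner_sub_right, hx.2, hy.2, sub_self]
    refine StarConvex.convex_of_collinear (a := f q) ?_ ⟨mem_image_of_mem f hqU, hqD, hqB⟩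
      (hcol.subset fun y hy => hy.2.1)
    rw [starConvex_iff_segment_subset]
    rintro _ ⟨⟨x, hxU, rfl⟩, hxDB⟩
    have hseg : segment ℝ (f q) (f x) ⊆ D ∩ B :=
      (hDconv.inter (convex_closedBall _ _)).segment_subset ⟨hqD, hqB⟩ hxDB
    refine subset_inter ?_ hseg
    by_cases hxq : x = q
    · subst hxq
      rw [segment_same]
      rintro _ rfl
      exact mem_image_of_mem f hxU
    have hfne : f q ≠ f x := fun heq => hxq (h.injOn hxU hqU heq.symm)
    -- The endpoint `f q` is left out because `q` may be nonplanar; every other point of the segment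
    -- can only come from planar points.
    set C : Set R3 := (AffineMap.lineMap (f q) (f x) : ℝ → R3) '' Ioc 0 1
    have hCseg : C ⊆ segment ℝ (f q) (f x) := by
      rw [segment_eq_image_lineMap]
      exact image_mono Ioc_subset_Icc_self
    have hCU : C ⊆ f '' U := by
      refine h.subset_image_of_isPreconnected hf.1
        (isPreconnected_Ioc.image _ (AffineMap.lineMap_continuous.continuousOn)) ?_ ?_ ?_
      · intro y hy
        have := (hseg (hCseg hy)).1
        exact h.mem_frontier_of_inner_eq this.1 this.2
      · intro x' hx'U hx'C
        refine hpl x' hx'U (hseg (hCseg hx'C)) ?_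
        rintro rfl
        obtain ⟨t, ht, htx⟩ := hx'C
        rw [AffineMap.lineMap_eq_left_iff] at htx
        exact htx.elim hfne ht.1.ne'
      · exact ⟨f x, ⟨1, ⟨one_pos, le_rfl⟩, AffineMap.lineMap_apply_one _ _⟩, mem_image_of_mem f hxU⟩
    rw [segment_eq_image_lineMap, ← Ioc_insert_left zero_le_one, image_insert_eq,
      AffineMap.lineMap_apply_zero]
    exact insert_subset (mem_image_of_mem f hqU) hCU
  · rintro x ⟨⟨hxU, hxB⟩, hxc⟩
    by_cases hxq : x = q
    · rwa [hxq]
    · obtain ⟨h1, h2⟩ := hpl x hxU ⟨⟨h.mem_of_mem hxU, hxc⟩, hxB⟩ hxq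
      exact subset_closure (h.mem_supportPoints h1 h2 hxc)

theorem tendsto_add_smul_sub_nhdsGT {E : Type*} [NormedAddCommGroup E] [NormedSpace ℝ E] (x y : E) :
    Filter.Tendsto (fun t : ℝ => (1 - t) • x + t • y) (𝓝[>] 0) (𝓝 x) := by
  have : Filter.Tendsto (fun t : ℝ => (1 - t) • x + t • y) (𝓝 0) (𝓝 ((1 - 0 : ℝ) • x + (0 : ℝ) • y)) :=
    Continuous.tendsto (by fun_prop) 0
  rw [zero_smul, add_zero, sub_zero, one_smul] at this
  exact this.mono_left nhdsWithin_le_nhds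

theorem IsSupportedPatch.eventually_inner_eq (h : IsSupportedPatch f n c U K) {y : R3}
    (hyc : inner ℝ n y = c) (hflat : ∀ᶠ y' in 𝓝 y, inner ℝ n y' = c → y' ∈ K) :
    ∀ᶠ y' in 𝓝 y, y' ∈ frontier K → inner ℝ n y' = c := by
  obtain ⟨z, hz⟩ := h.isConvexBody.2.2
  refine eventually_mem_hyperplane_of_mem_frontier h.convex hz (h.inner_ne z hz) hyc ?_
  filter_upwards [hflat] with y' hy' hy'c
  exact h.mem_frontier_of_inner_eq (hy' hy'c) hy'c

/-- If the face fills `H` near `f x`, then the frontier of `K` lies in `H` there and `f` is flat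
near `x`, which nonflatness forbids on ∂M. -/
theorem IsSupportedPatch.isPlanarPoint_of_flat [ChartedSpace (EuclideanHalfSpace 2) M]
    (h : IsSupportedPatch f n c U K) (hf : Continuous f) (hnf : IsLocallyNonflatAlongBoundary f)
    (hn : n ≠ 0) {x : M} (hx : x ∈ interior U) (hxc : inner ℝ n (f x) = c)
    (hflat : ∀ᶠ y in 𝓝 (f x), inner ℝ n y = c → y ∈ K) : IsPlanarPoint x := by
  by_contra hxp
  refine hnf x (mem_boundary_of_not_isPlanarPoint hxp) _ (Filter.inter_mem
    (mem_interior_iff_mem_nhds.mp hx)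
    (hf.continuousAt.preimage_mem_nhds (h.eventually_inner_eq hxc hflat)))
    ⟨{y | inner ℝ n y = c}, ⟨n, c, hn, rfl⟩, ?_⟩
  rintro _ ⟨x', ⟨hx'U, hx'⟩, rfl⟩
  exact hx' (h.mem_frontier x' hx'U)

/-- The local analysis at a boundary point for which the face `K ∩ H` of the convex body has
interior points in `H`. -/
theorem hasConvexPatch_of_interior_nonempty [T2Space M] [CompactSpace M]
    [ChartedSpace (EuclideanHalfSpace 2) M] (hf : IsLocallyConvexImmersion f)
    (hnf : IsLocallyNonflatAlongBoundary f) (hn : n ≠ 0) {q : M}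
    (hq : q ∈ closure (supportPoints f n c)) (hU : U ∈ 𝓝 q) (h : IsSupportedPatch f n c U K)
    (hint : (interior ((ℝ ∙ n)ᗮ.orthogonalProjectionOnto ''
      (K ∩ {y | inner ℝ n y = c}))).Nonempty) : HasConvexPatch f n c q := by
  obtain ⟨r, hr, hN⟩ := h.exists_radius hf.1 (mem_of_mem_nhds hU) (interior_mem_nhds.mpr hU)
  set D := K ∩ {y | inner ℝ n y = c}
  have hDconv : Convex ℝ D := h.convex.inter (convex_plane n c)
  set P := (ℝ ∙ n)ᗮ.orthogonalProjectionOnto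
  have hPD : Convex ℝ (P '' D) := hDconv.linear_image P.toLinearMap
  have hPinj := injOn_orthogonalProjectionOnto_plane n c
  set B := Metric.closedBall (f q) r
  -- The relative interior of the face within the ball: convex, hence connected, and reached in `U`
  -- only by planar points.
  set C := D ∩ B ∩ P ⁻¹' interior (P '' D)
  have hCconv : Convex ℝ C := (hDconv.inter (convex_closedBall _ _)).inter
    (hPD.interior.linear_preimage P.toLinearMap)
  have hflat : ∀ y ∈ D, P y ∈ interior (P '' D) → ∀ᶠ y' in 𝓝 y, inner ℝ n y' = c → y' ∈ K := by
    intro y hy hyi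
    filter_upwards [P.continuous.continuousAt.preimage_mem_nhds (isOpen_interior.mem_nhds hyi)]
      with y' hy' hy'c
    obtain ⟨d, hd, hdy⟩ := interior_subset hy'
    rw [← hPinj hd.2 hy'c hdy]
    exact hd.1
  have hCp : ∀ x ∈ U, f x ∈ C → x ∈ interior U ∧ IsPlanarPoint x := by
    rintro x hxU ⟨⟨hxD, hxB⟩, hxi⟩
    have h1 := hN x hxU hxB
    exact ⟨h1, h.isPlanarPoint_of_flat hf.1 hnf hn h1 hxD.2 (hflat _ hxD hxi)⟩
  have hcomb : ∀ x ∈ D, ∀ y ∈ D, P y ∈ interior (P '' D) → ∀ t : ℝ, 0 < t → t ≤ 1 →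
      (1 - t) • x + t • y ∈ D ∧ P ((1 - t) • x + t • y) ∈ interior (P '' D) := by
    intro x hx y hy hyi t ht0 ht1
    refine ⟨hDconv hx hy (by linarith) ht0.le (by ring), ?_⟩
    rw [map_add, map_smul, map_smul]
    exact hPD.combo_closure_interior_mem_interior (subset_closure (mem_image_of_mem P hx)) hyi
      (by linarith) ht0 (by ring)
  have hIoc : ∀ᶠ t : ℝ in 𝓝[>] 0, t ∈ Ioc (0 : ℝ) 1 := Ioc_mem_nhdsGT one_pos
  obtain ⟨o, ho⟩ := hint
  obtain ⟨d₀, hd₀, rfl⟩ := interior_subset ho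
  -- At a support point near `q` the image fills the frontier of `K`; a small move towards the
  -- relative interior point `d₀` stays in the image and enters `C`.
  have hCne : (C ∩ f '' U).Nonempty := by
    obtain ⟨s, ⟨hsU, hsB⟩, hs⟩ := mem_closure_iff_nhds.mp hq _
      (Filter.inter_mem (interior_mem_nhds.mpr hU)
      (hf.1.continuousAt.preimage_mem_nhds (Metric.ball_mem_nhds (f q) hr)))
    have hsD : f s ∈ D := ⟨h.mem_of_mem (interior_subset hsU), hs.2.1⟩
    have hlim := tendsto_add_smul_sub_nhdsGT (f s) d₀
    obtain ⟨t, ht, htB, htU⟩ := (hIoc.and ((hlim.eventually (Metric.isOpen_ball.mem_nhds hsB)).and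
      (hlim.eventually (h.eventually_mem_image hf.1 hsU hs.1)))).exists
    obtain ⟨h1, h2⟩ := hcomb _ hsD _ hd₀ ho t ht.1 ht.2
    exact ⟨_, ⟨⟨h1, Metric.ball_subset_closedBall htB⟩, h2⟩,
      htU (h.mem_frontier_of_inner_eq h1.1 h1.2)⟩
  have hCU : C ⊆ f '' U := h.subset_image_of_isPreconnected hf.1 hCconv.isPreconnected
    (fun y hy => h.mem_frontier_of_inner_eq hy.1.1.1 hy.1.1.2) hCp hCne
  -- Every point of the face in the ball is a limit of points of `C`, and the image of a compact set
  -- is closed.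
  have hcl : D ∩ B ⊆ f '' (U ∩ closure (supportPoints f n c)) := by
    have hclosed : IsClosed (f '' (U ∩ closure (supportPoints f n c))) :=
      ((h.isCompact.inter_right isClosed_closure).image hf.1).isClosed
    have hCS : C ⊆ f '' (U ∩ closure (supportPoints f n c)) := by
      intro y hy
      obtain ⟨x, hxU, rfl⟩ := hCU hy
      obtain ⟨h1, h2⟩ := hCp x hxU hy
      exact ⟨x, ⟨hxU, subset_closure (h.mem_supportPoints h1 h2 hy.1.1.2)⟩, rfl⟩
    rintro y ⟨hyD, hyB⟩
    obtain ⟨y₀, hy₀, -⟩ := hCne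
    refine hclosed.mem_of_tendsto (tendsto_add_smul_sub_nhdsGT y y₀) ?_
    filter_upwards [hIoc] with t ht
    obtain ⟨h1, h2⟩ := hcomb _ hyD _ hy₀.1.1 hy₀.2 t ht.1 ht.2
    exact hCS ⟨⟨h1, convex_closedBall _ _ hyB hy₀.1.2 (by linarith [ht.2]) ht.1.le (by ring)⟩, h2⟩
  refine ⟨U ∩ f ⁻¹' B, Filter.inter_mem hU (hf.1.continuousAt.preimage_mem_nhds
    (Metric.closedBall_mem_nhds _ hr)),
    ⟨K, h.mono inter_subset_left (h.isCompact.inter_right (Metric.isClosed_closedBall.preimage hf.1))⟩,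
    ?_, ?_⟩
  · rw [IsSupportedPatch.image_inter_eq]
    have : f '' U ∩ ({y | inner ℝ n y = c} ∩ B) = D ∩ B := by
      ext y
      constructor
      · rintro ⟨⟨x, hx, rfl⟩, hy⟩
        exact ⟨⟨h.mem_of_mem hx, hy.1⟩, hy.2⟩
      · intro hy
        exact ⟨image_mono inter_subset_left (hcl hy), hy.1.2, hy.2⟩
    rw [this]
    exact hDconv.inter (convex_closedBall _ _)
  · rintro x ⟨⟨hxU, hxB⟩, hxc⟩
    obtain ⟨x', ⟨hx'U, hx'S⟩, hx'⟩ := hcl ⟨⟨h.mem_of_mem hxU, hxc⟩, hxB⟩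
    rwa [← h.injOn hx'U hxU hx']

/-- At a nonplanar point the face either has interior in `H` or, being convex, lies in a line of
`H`; nonflatness handles the first case and absence of inflections the second. -/
theorem hasConvexPatch [T2Space M] [CompactSpace M]
    [ChartedSpace (EuclideanHalfSpace 2) M] (hf : IsLocallyConvexImmersion f)
    (hnf : IsLocallyNonflatAlongBoundary f) (hbd : IsC2WithoutInflectionsOnBoundary f) (hn : n ≠ 0)
    {q : M} (hq : q ∈ closure (supportPoints f n c)) : HasConvexPatch f n c q := by
  by_cases hqp : IsPlanarPoint q
  · exact hasConvexPatch_of_isPlanarPoint hf hn hq hqp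
  have hqb := mem_boundary_of_not_isPlanarPoint hqp
  have hqc : inner ℝ n (f q) = c :=
    closure_minimal (fun x hx => hx.2.1) (isClosed_setOf_inner_eq hf.1) hq
  obtain ⟨U, hU, -, K, h⟩ := exists_isSupportedPatch hf hn hq Filter.univ_mem
  by_cases hint : (interior ((ℝ ∙ n)ᗮ.orthogonalProjectionOnto ''
      (K ∩ {y | inner ℝ n y = c}))).Nonempty
  · exact hasConvexPatch_of_interior_nonempty hf hnf hn hq hU h hint
  obtain ⟨e, he, hlin⟩ := exists_ne_zero_inner_sub_eq_zero
    ((h.convex.inter (convex_plane n c)).linear_image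
      (ℝ ∙ n)ᗮ.orthogonalProjectionOnto.toLinearMap)
    (Set.Nonempty.image _ ⟨f q, h.mem_of_mem (mem_of_mem_nhds hU), hqc⟩) hint
  refine hasConvexPatch_of_linear hf hbd hn hq hqc hqb hU h (e := (e : R3))
    (by simpa using he) (Submodule.mem_orthogonal_singleton_iff_inner_right.mp e.2) ?_
  intro x hx y hy
  have := hlin _ (mem_image_of_mem _ hx) _ (mem_image_of_mem _ hy)
  rw [ContinuousLinearMap.coe_coe, ← map_sub] at this
  rwa [Submodule.inner_orthogonalProjectionOnto_eq_of_mem_left] at this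

end LocalStructure

/-! ### Convexity of the component and its side of the plane. -/

section GlobalStructure

theorem IsCompact.isPreconnected_of_image {X Y : Type*} [TopologicalSpace X] [TopologicalSpace Y]
    [T2Space Y] {g : X → Y} {V : Set X} (hV : IsCompact V) (hg : ContinuousOn g V)
    (hinj : InjOn g V) (himg : IsPreconnected (g '' V)) : IsPreconnected V := by
  have : CompactSpace V := isCompact_iff_compactSpace.mp hV
  have hemb : IsClosedEmbedding (V.domRestrict g) :=
    (continuousOn_iff_continuous_domRestrict.mp hg).isClosedEmbedding (injOn_iff_injective.mp hinj)
  have h1 : IsPreconnected (univ : Set V) := by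
    rw [← hemb.isInducing.isPreconnected_image, image_univ, range_domRestrict]
    exact himg
  simpa using h1.image Subtype.val continuous_subtype_val.continuousOn

/-- With interior points the frontier is homeomorphic to a sphere; without them it is the convex set
itself. -/
theorem Convex.isPreconnected_frontier {E : Type*} [NormedAddCommGroup E] [NormedSpace ℝ E]
    (hE : 1 < Module.rank ℝ E) {D : Set E} (hD : Convex ℝ D) (hc : IsCompact D) :
    IsPreconnected (frontier D) := by
  rcases (interior D).eq_empty_or_nonempty with he | hne
  · rw [frontier, he, sdiff_empty, hc.isClosed.closure_eq]
    exact hD.isPreconnected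
  · obtain ⟨h, -, -, hfr⟩ :=
      exists_homeomorph_image_interior_closure_frontier_eq_unitBall hD hne hc.isBounded
    rw [← h.isInducing.isPreconnected_image, hfr]
    exact isPreconnected_sphere hE 0 1

theorem isClosed_connectedComponentIn {X : Type*} [TopologicalSpace X] {F : Set X}
    (hF : IsClosed F) {x : X} (hx : x ∈ F) : IsClosed (connectedComponentIn F x) :=
  isClosed_of_closure_subset <| isPreconnected_connectedComponentIn.closure.subset_connectedComponentIn
    (subset_closure (mem_connectedComponentIn hx))
    (closure_minimal (connectedComponentIn_subset F x) hF)

variable {M : Type*} [TopologicalSpace M] {f : M → R3} {n : R3} {c : ℝ} {p : M}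

/-- The last clause of `HasConvexPatch` makes the closure of the support points relatively open in
f⁻¹(H), besides being closed. -/
theorem connectedComponentIn_subset_closure_supportPoints
    (hloc : ∀ q ∈ closure (supportPoints f n c), HasConvexPatch f n c q)
    (hp : p ∈ supportPoints f n c) :
    connectedComponentIn {x | inner ℝ n (f x) = c} p ⊆ closure (supportPoints f n c) := by
  set F : Set M := {x | inner ℝ n (f x) = c}
  let G : Set M := {q | ∀ᶠ x in 𝓝 q, x ∈ F → x ∈ closure (supportPoints f n c)}
  have hG : IsOpen G := by
    rw [isOpen_iff_mem_nhds]
    exact fun y hy => eventually_eventually_nhds.mpr hy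
  have hsub : closure (supportPoints f n c) ⊆ G := by
    intro q hq
    obtain ⟨U, hU, -, -, hUS⟩ := hloc q hq
    exact Filter.eventually_of_mem hU fun x hxU hxF => hUS ⟨hxU, hxF⟩
  by_contra hcon
  obtain ⟨x, hx, hxS⟩ := not_subset.mp hcon
  obtain ⟨y, hyA, hyG, hyS⟩ := isPreconnected_connectedComponentIn (F := F) (x := p) G
    (closure (supportPoints f n c))ᶜ hG isClosed_closure.isOpen_compl
    (fun w _ => (em (w ∈ closure (supportPoints f n c))).imp_left fun h => hsub h)
    ⟨p, mem_connectedComponentIn hp.2.1, hsub (subset_closure hp)⟩ ⟨x, hx, hxS⟩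
  exact hyS (mem_of_mem_nhds hyG (connectedComponentIn_subset F p hyA))

/-- A component `A` of `f ⁻¹' H` all of whose points have neighborhoods in `M` which are embedded in
the boundary of a convex body supported by `H`, and meet `f ⁻¹' H` in a part of `A` with convex
image. -/
structure IsConvexComponent (f : M → R3) (n : R3) (c : ℝ) (A : Set M) : Prop where
  isClosed : IsClosed A
  isConnected : IsConnected A
  inner_eq : ∀ x ∈ A, inner ℝ n (f x) = c
  exists_patch : ∀ q ∈ A, ∃ U ∈ 𝓝 q, (∃ K, IsSupportedPatch f n c U K) ∧
    Convex ℝ (f '' (U ∩ A)) ∧ ∀ x ∈ U, inner ℝ n (f x) = c → x ∈ A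

theorem isConvexComponent_connectedComponentIn (hf : Continuous f)
    (hloc : ∀ q ∈ closure (supportPoints f n c), HasConvexPatch f n c q)
    (hp : p ∈ supportPoints f n c) :
    IsConvexComponent f n c (connectedComponentIn {x | inner ℝ n (f x) = c} p) := by
  set F : Set M := {x | inner ℝ n (f x) = c}
  have hpF : p ∈ F := hp.2.1
  refine ⟨isClosed_connectedComponentIn (isClosed_setOf_inner_eq hf) hpF, isConnected_connectedComponentIn_iff.mpr hpF,
    fun x hx => connectedComponentIn_subset F p hx, fun q hq => ?_⟩
  obtain ⟨U, hU, ⟨K, h⟩, hconv, -⟩ :=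
    hloc q (connectedComponentIn_subset_closure_supportPoints hloc hp hq)
  have hqF : q ∈ F := connectedComponentIn_subset F p hq
  -- The compact set `U ∩ F` is embedded onto a convex set, so it is connected and lies in one
  -- component of `F`.
  have hpre : IsPreconnected (U ∩ F) :=
    (h.isCompact.inter_right (isClosed_setOf_inner_eq hf)).isPreconnected_of_image hf.continuousOn
      (h.injOn.mono inter_subset_left) hconv.isPreconnected
  have hsub : U ∩ F ⊆ connectedComponentIn F p := by
    rw [connectedComponentIn_eq hq]
    exact hpre.subset_connectedComponentIn ⟨mem_of_mem_nhds hU, hqF⟩ inter_subset_right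
  have heq : U ∩ connectedComponentIn F p = U ∩ F :=
    Subset.antisymm (inter_subset_inter_right _ (connectedComponentIn_subset F p))
      (subset_inter inter_subset_left hsub)
  exact ⟨U, hU, ⟨K, h⟩, by rwa [heq], fun x hxU hxF => hsub ⟨hxU, hxF⟩⟩

namespace IsConvexComponent

variable {A : Set M}

theorem injOn_and_convex [T2Space M] [CompactSpace M] (hA : IsConvexComponent f n c A)
    (hf : Continuous f) : InjOn f A ∧ Convex ℝ (f '' A) := by
  have : CompactSpace A := isCompact_iff_compactSpace.mp hA.isClosed.isCompact
  have : PreconnectedSpace A := isPreconnected_iff_preconnectedSpace.mp hA.isConnected.isPreconnected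
  have key := injective_and_convex_range_of_local (f := A.domRestrict f)
    (hf.comp continuous_subtype_val) (fun q => by
      obtain ⟨U, hU, ⟨K, h⟩, hconv, -⟩ := hA.exists_patch q q.2
      refine ⟨Subtype.val ⁻¹' U, continuous_subtype_val.continuousAt.preimage_mem_nhds hU,
        h.isCompact.isClosed.preimage continuous_subtype_val, ?_, ?_⟩
      · intro a ha b hb hab
        exact Subtype.ext (h.injOn ha hb hab)
      · have : A.domRestrict f '' (Subtype.val ⁻¹' U) = f '' (U ∩ A) := by
          rw [domRestrict_eq, image_comp, Subtype.image_preimage_coe, inter_comm]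
        rwa [this])
  rwa [range_domRestrict, ← injOn_iff_injective] at key

/-- Global injectivity on `A` is what matters: points of `A` outside `U` cannot have images near `f
q`. -/
theorem eventually_mem_convexBody [T2Space M] [CompactSpace M] (hA : IsConvexComponent f n c A)
    (hf : Continuous f) {q : M} (hq : q ∈ A) {U : Set M} {K : Set R3} (hU : U ∈ 𝓝 q)
    (h : IsSupportedPatch f n c U K) : ∀ᶠ y in 𝓝 (f q), y ∈ f '' A → y ∈ K := by
  have hc : IsCompact (f '' (A \ interior U)) := (hA.isClosed.isCompact.diff isOpen_interior).image hf
  have hqn : f q ∉ f '' (A \ interior U) := by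
    rintro ⟨x, ⟨hxA, hxU⟩, hx⟩
    rw [(hA.injOn_and_convex hf).1 hxA hq hx] at hxU
    exact hxU (mem_interior_iff_mem_nhds.mpr hU)
  filter_upwards [hc.isClosed.isOpen_compl.mem_nhds hqn]
  rintro _ hy ⟨x, hxA, rfl⟩
  by_contra hxK
  exact hy ⟨x, ⟨hxA, fun hxU => hxK (h.mem_of_mem (interior_subset hxU))⟩, rfl⟩

/-- Near `f q` the set `f '' A` fills `H` and lies in `K`, so the frontier of `K`, and with it `f`,
stays in `H`. -/
theorem flat_of_mem_interior [T2Space M] [CompactSpace M] (hA : IsConvexComponent f n c A)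
    (hf : Continuous f) {q : M} (hq : q ∈ A)
    (hint : (ℝ ∙ n)ᗮ.orthogonalProjectionOnto (f q) ∈
      interior ((ℝ ∙ n)ᗮ.orthogonalProjectionOnto '' (f '' A))) :
    ∀ᶠ x in 𝓝 q, inner ℝ n (f x) = c := by
  obtain ⟨U, hU, ⟨K, h⟩, -, -⟩ := hA.exists_patch q hq
  have hflat : ∀ᶠ y in 𝓝 (f q), inner ℝ n y = c → y ∈ K := by
    filter_upwards [hA.eventually_mem_convexBody hf hq hU h,
      ((ℝ ∙ n)ᗮ.orthogonalProjectionOnto).continuous.continuousAt.preimage_mem_nhds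
        (isOpen_interior.mem_nhds hint)] with y hyK hy hyc
    obtain ⟨_, ⟨x, hx, rfl⟩, hxy⟩ := interior_subset hy
    have := injOn_orthogonalProjectionOnto_plane n c (hA.inner_eq x hx) hyc hxy
    exact hyK ⟨x, hx, this⟩
  filter_upwards [hU, hf.continuousAt.eventually
    (h.eventually_inner_eq (hA.inner_eq q hq) hflat)] with x hxU hx
  exact hx (h.mem_frontier x hxU)

variable [ChartedSpace (EuclideanHalfSpace 2) M]

/-- At a point of `A` near which `f` is flat, `f '' A` contains a neighborhood in the plane. -/
theorem mem_interior_of_flat (hA : IsConvexComponent f n c A)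
    (hf : Continuous f) (hnf : IsLocallyNonflatAlongBoundary f) (hn : n ≠ 0) {q : M} (hq : q ∈ A)
    (hflat : ∀ᶠ x in 𝓝 q, inner ℝ n (f x) = c) :
    (ℝ ∙ n)ᗮ.orthogonalProjectionOnto (f q) ∈
      interior ((ℝ ∙ n)ᗮ.orthogonalProjectionOnto '' (f '' A)) := by
  obtain ⟨U, hU, ⟨K, h⟩, -, hUA⟩ := hA.exists_patch q hq
  have hqp : IsPlanarPoint q := by
    by_contra hqp
    refine hnf q (mem_boundary_of_not_isPlanarPoint hqp) _ hflat ⟨_, ⟨n, c, hn, rfl⟩, ?_⟩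
    rintro _ ⟨x, hx, rfl⟩
    exact hx
  have hev := hqp.eventually_mem_image_plane hf (Filter.inter_mem hU hflat)
    (h.injOn.mono inter_subset_left) hn (fun x hx => hx.2)
  set P := (ℝ ∙ n)ᗮ.orthogonalProjectionOnto
  have hlim : Filter.Tendsto (fun w : (ℝ ∙ n)ᗮ => f q + ((w - P (f q) : (ℝ ∙ n)ᗮ) : R3))
      (𝓝 (P (f q))) (𝓝 (f q)) := by
    have : Filter.Tendsto (fun w : (ℝ ∙ n)ᗮ => f q + ((w - P (f q) : (ℝ ∙ n)ᗮ) : R3))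
      (𝓝 (P (f q))) (𝓝 (f q + ((P (f q) - P (f q) : (ℝ ∙ n)ᗮ) : R3))) :=
      Continuous.tendsto (by fun_prop) _
    simpa using this
  rw [mem_interior_iff_mem_nhds]
  filter_upwards [hlim.eventually hev] with w hw
  have hin : inner ℝ n (f q + ((w - P (f q) : (ℝ ∙ n)ᗮ) : R3)) = c := by
    rw [inner_add_right, hA.inner_eq q hq,
      Submodule.mem_orthogonal_singleton_iff_inner_right.mp (w - P (f q)).2, add_zero]
  obtain ⟨x, ⟨hxU, hxc⟩, hx⟩ := hw hin
  refine ⟨f x, mem_image_of_mem f (hUA x hxU hxc), ?_⟩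
  rw [hx, map_add, Submodule.orthogonalProjectionOnto_mem_subspace_eq_self]
  abel

/-- Points over the relative interior of `f '' A` are flat and lie on both sides. The set `T` of the
other points is embedded onto the frontier of a convex set in dimension two, hence connected; none
of its points is flat, so the two open side conditions are disjoint on it and one of them holds
throughout. -/
theorem one_sided [T2Space M] [CompactSpace M] (hA : IsConvexComponent f n c A)
    (hf : Continuous f) (hnf : IsLocallyNonflatAlongBoundary f) (hn : n ≠ 0) :
    (∀ q ∈ A, ∀ᶠ x in 𝓝 q, inner ℝ n (f x) ≤ c) ∨ ∀ q ∈ A, ∀ᶠ x in 𝓝 q, c ≤ inner ℝ n (f x) := by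
  obtain ⟨hinj, hconv⟩ := hA.injOn_and_convex hf
  set P := (ℝ ∙ n)ᗮ.orthogonalProjectionOnto
  set D := P '' (f '' A)
  have hDc : IsCompact D := (hA.isClosed.isCompact.image hf).image P.continuous
  have hD : Convex ℝ D := hconv.linear_image P.toLinearMap
  have hPf : Continuous fun x => P (f x) := P.continuous.comp hf
  set T := A ∩ (fun x => P (f x)) ⁻¹' frontier D
  have hT : IsPreconnected T := by
    refine IsCompact.isPreconnected_of_image (g := fun x => P (f x))
      (hA.isClosed.isCompact.inter_right (isClosed_frontier.preimage hPf)) hPf.continuousOn ?_ ?_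
    · intro a ha b hb hab
      exact hinj ha.1 hb.1 (injOn_orthogonalProjectionOnto_plane n c (hA.inner_eq a ha.1)
        (hA.inner_eq b hb.1) hab)
    · have : (fun x => P (f x)) '' T = frontier D := by
        ext y
        constructor
        · rintro ⟨x, hx, rfl⟩
          exact hx.2
        · intro hy
          obtain ⟨_, ⟨x, hx, rfl⟩, rfl⟩ := hDc.isClosed.frontier_subset hy
          exact ⟨x, ⟨hx, hy⟩, rfl⟩
      rw [this]
      refine hD.isPreconnected_frontier ?_ hDc
      rw [← Module.finrank_eq_rank, finrank_orthogonal_singleton_R3 hn]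
      norm_num
  let Up : Set M := {q | ∀ᶠ x in 𝓝 q, inner ℝ n (f x) ≤ c}
  let Dn : Set M := {q | ∀ᶠ x in 𝓝 q, c ≤ inner ℝ n (f x)}
  have hUp : IsOpen Up := isOpen_iff_mem_nhds.mpr fun y hy => eventually_eventually_nhds.mpr hy
  have hDn : IsOpen Dn := isOpen_iff_mem_nhds.mpr fun y hy => eventually_eventually_nhds.mpr hy
  have hcov : ∀ q ∈ A, q ∈ Up ∨ q ∈ Dn := fun q hq => by
    obtain ⟨U, hU, ⟨K, h⟩, -, -⟩ := hA.exists_patch q hq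
    exact h.one_sided.imp (Filter.eventually_of_mem hU) (Filter.eventually_of_mem hU)
  have hflat : ∀ q ∈ A, q ∉ T → q ∈ Up ∧ q ∈ Dn := fun q hq hqT => by
    have hint : P (f q) ∈ interior D := by
      by_contra hn
      exact hqT ⟨hq, subset_closure (mem_image_of_mem P (mem_image_of_mem f hq)), hn⟩
    have := hA.flat_of_mem_interior hf hq hint
    exact ⟨this.mono fun x hx => hx.le, this.mono fun x hx => hx.ge⟩
  have hdisj : ∀ q ∈ T, q ∈ Up → q ∉ Dn := fun q hq h1 h2 => by
    refine hq.2.2 (hA.mem_interior_of_flat hf hnf hn hq.1 ?_)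
    filter_upwards [h1, h2] with x hx1 hx2 using le_antisymm hx1 hx2
  by_cases hne : (T ∩ Up).Nonempty
  · left
    intro q hq
    by_contra hqU
    have hqT : q ∈ T := by
      by_contra hqT
      exact hqU (hflat q hq hqT).1
    obtain ⟨x, hxT, hx1, hx2⟩ := hT Up Dn hUp hDn (fun x hx => hcov x hx.1) hne
      ⟨q, hqT, (hcov q hq).resolve_left hqU⟩
    exact hdisj x hxT hx1 hx2
  · right
    intro q hq
    by_cases hqT : q ∈ T
    · exact (hcov q hq).resolve_left fun h => hne ⟨q, hqT, h⟩
    · exact (hflat q hq hqT).2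

theorem isDegenerateCap [T2Space M] [CompactSpace M] (hA : IsConvexComponent f n c A)
    (hf : Continuous f) (hnf : IsLocallyNonflatAlongBoundary f) (hn : n ≠ 0) :
    IsDegenerateCap f A {y | inner ℝ n y = c} := by
  obtain ⟨hinj, hconv⟩ := hA.injOn_and_convex hf
  refine ⟨hA.isClosed, hA.isConnected, hinj, ⟨⟨n, c, hn, rfl⟩, hA.isConnected.nonempty.image f,
    hA.isClosed.isCompact.image hf, hconv, ?_⟩, ?_⟩
  · rintro _ ⟨x, hx, rfl⟩
    exact hA.inner_eq x hx
  have hmem : ∀ q ∈ A, ∀ᶠ x in 𝓝 q, inner ℝ n (f x) = c → x ∈ A := fun q hq => by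
    obtain ⟨U, hU, -, -, hUA⟩ := hA.exists_patch q hq
    exact Filter.eventually_of_mem hU hUA
  rcases hA.one_sided hf hnf hn with hside | hside
  -- Near `A` only points of `A` are mapped to `H`, so the weak inequality is strict off `A`, and
  -- the opposite closed half-space is avoided.
  · refine ⟨{x | inner ℝ n (f x) ≤ c ∧ (inner ℝ n (f x) = c → x ∈ A)},
      mem_nhdsSet_iff_forall.mpr fun q hq => (hside q hq).and (hmem q hq),
      {y | c ≤ inner ℝ n y}, ⟨n, c, hn, rfl, rfl⟩, ?_⟩
    rw [disjoint_left]
    rintro _ ⟨x, ⟨⟨hx1, hx2⟩, hxA⟩, rfl⟩ hx3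
    exact hxA (hx2 (le_antisymm hx1 hx3))
  · refine ⟨{x | c ≤ inner ℝ n (f x) ∧ (inner ℝ n (f x) = c → x ∈ A)},
      mem_nhdsSet_iff_forall.mpr fun q hq => (hside q hq).and (hmem q hq),
      {y | -c ≤ inner ℝ (-n) y}, ⟨-n, -c, neg_ne_zero.mpr hn, ?_, rfl⟩, ?_⟩
    · ext y
      simp only [mem_ofPred_eq, inner_neg_left, neg_inj]
    · rw [disjoint_left]
      rintro _ ⟨x, ⟨⟨hx1, hx2⟩, hxA⟩, rfl⟩ hx3
      simp only [mem_ofPred_eq, inner_neg_left, neg_le_neg_iff] at hx3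
      exact hxA (hx2 (le_antisymm hx3 hx1))

end IsConvexComponent

end GlobalStructure

theorem mainTheorem7 {M : Type*} [TopologicalSpace M] [T2Space M] [CompactSpace M]
    [ConnectedSpace M] [ChartedSpace (EuclideanHalfSpace 2) M] (f : M → R3)
    (hf : IsLocallyConvexImmersion f)
    (hnonflat : IsLocallyNonflatAlongBoundary f)
    (hboundary : IsC2WithoutInflectionsOnBoundary f)
    (p : M) (hp : p ∈ (𝓡∂ 2).interior M)
    (H : Set R3) (hH : IsLocalSupportPlane f H p) :
    IsDegenerateCap f (connectedComponentIn (f ⁻¹' H) p) H := by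
  -- The equation of `H` is taken from the side `S`, so that the local support condition reads as `c
  -- ≤ inner ℝ n (f x)` with the same `n` and `c`.
  obtain ⟨-, hpH, U, hU, S, ⟨n, c, hn, rfl, rfl⟩, hUS⟩ := hH
  have hpS : p ∈ supportPoints f n c := ⟨isPlanarPoint_of_mem_interior hp, hpH,
    Or.inr (Filter.eventually_of_mem hU fun x hx => hUS (mem_image_of_mem f hx))⟩
  exact (isConvexComponent_connectedComponentIn hf.1
    (fun q hq => hasConvexPatch hf hnonflat hboundary hn hq) hpS).isDegenerateCap hf.1 hnonflat hn
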